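/- Let $(\Omega,\mathcal F)$ be a measurable space and let $\mathcal L^\infty(\Omega,\mathcal F)$ be the space of bounded $\mathcal F$-measurable functions $X\colon\Omega\to\mathbb R$, with the pointwise order and the supremum norm. Let $M\subset\mathcal L^\infty(\Omega,\mathcal F)$ be a Riesz subspace (a linear subspace closed under pointwise minima) with $1\in M$ and $\mathcal F=\sigma(M)$. A pre-expectation on a linear subspace $N\subset\mathcal L^\infty(\Omega,\mathcal F)$ containing the constants is a map $\mathcal E\colon N\to\mathbb R$ with $\mathcal E(X)\le\mathcal E(Y)$ whenever $X\le Y$ and with $\mathcal E(\alpha)=\alpha$ for all $\alpha\in\mathbb R$; it is called an expectation if $N=\mathcal L^\infty(\Omega,\mathcal F)$. It is continuous from above on a set $S\subset N$ if $\mathcal E(X_n)\searrow\mathcal E(X)$ for all $X_n,X\in S$ with $X_n\searrow X$ pointwise, and continuous from below on $S$ if $\mathcal E(X_n)\nearrow\mathcal E(X)$ for all $X_n,X\in S$ with $X_n\nearrow X$ pointwise; when $S=N$, the set is not mentioned. Let $M_\delta$ be the set of all bounded functions $X\colon\Omega\to\mathbb R$ for which there is a sequence $(X_n)$ in $M$ with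 $X_n\searrow X$ pointwise; then $M_\delta\subset\mathcal L^\infty(\Omega,\mathcal F)$. For a functional $\mathcal E\colon N\to\mathbb R$ and a linear functional $\mu\colon N\to\mathbb R$, let $\mathcal E^*(\mu):=\sup_{X\in N}(\mu X-\mathcal E(X))\in[-\infty,\infty]$. Let $M'$ be the topological dual of $M$, let $\mathrm{ca}_+^1(\Omega,\mathcal F)$ be the set of probability measures on $(\Omega,\mathcal F)$, and write $\nu X:=\int X\,d\nu$ for $\nu\in\mathrm{ca}_+^1(\Omega,\mathcal F)$ and $X\in\mathcal L^\infty(\Omega,\mathcal F)$. For a functional $\mathcal E\colon M\to\mathbb R$ and $X\in\mathcal L^\infty(\Omega,\mathcal F)$ define \[ \bar{\mathcal E}(X):=\sup\Big\{\inf_{n\in\mathbb N}\mathcal E(X_n)\colon (X_n)_{n\in\mathbb N}\in M^{\mathbb N},\ X_n\ge X_{n+1}\ (n\in\mathbb N),\ X\ge\inf_{n\in\mathbb N}X_n\Big\}, \] where the infima and the supremum are taken in $[-\infty,\infty]$. Theorem. Let $\mathcal E\colon M\to\mathbb R$ be a convex pre-expectation that is continuous from above. Then $\bar{\mathcal E}$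 takes only finite values, and it is the unique expectation on $\mathcal L^\infty(\Omega,\mathcal F)$ that extends $\mathcal E$, is continuous from below, and is continuous from above on $M_\delta$. Moreover, $\bar{\mathcal E}$ is convex, and for all $X\in\mathcal L^\infty(\Omega,\mathcal F)$ \[ \bar{\mathcal E}(X)=\sup_{\mu\in M',\ \mathcal E^*(\mu)<\infty}\big(\bar\mu(X)-\mathcal E^*(\mu)\big)=\sup_{\nu\in\mathrm{ca}_+^1(\Omega,\mathcal F)}\big(\nu X-\mathcal E^*(\nu|_M)\big). \] In particular, $(\Omega,\mathcal F,\bar{\mathcal E})$ is a convex expectation space, that is, $\bar{\mathcal E}$ is a convex expectation and there is a set $\mathcal P\subset\mathrm{ca}_+^1(\Omega,\mathcal F)$ with $\bar{\mathcal E}(X)=\sup_{\nu\in\mathcal P}\big(\nu X-\bar{\mathcal E}^*(\nu)\big)$ for all $X\in\mathcal L^\infty(\Omega,\mathcal F)$. -/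

import Mathlib

open MeasureTheory Filter Topology

noncomputable section

namespace NonlinearExpectation

variable {Ω : Type*}

/-- A real-valued function that is bounded in absolute value. -/
def IsBoundedFun (X : Ω → ℝ) : Prop := ∃ C : ℝ, ∀ ω, |X ω| ≤ C

/-- The space of all bounded measurable functions `Ω → ℝ` (functions, not classes modulo null
sets), with the pointwise order inherited from `Ω → ℝ`. -/
def LInfty (Ω : Type*) [MeasurableSpace Ω] : Submodule ℝ (Ω → ℝ) where
  carrier := {X | Measurable X ∧ IsBoundedFun X}
  add_mem' := by
    rintro X Y ⟨hX, C, hC⟩ ⟨hY, D, hD⟩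
    exact ⟨hX.add hY, C + D, fun ω => (abs_add_le _ _).trans (add_le_add (hC ω) (hD ω))⟩
  zero_mem' := ⟨measurable_const, 0, fun ω => by simp⟩
  smul_mem' := by
    rintro a X ⟨hX, C, hC⟩
    refine ⟨hX.const_smul a, |a| * C, fun ω => ?_⟩
    simp only [Pi.smul_apply, smul_eq_mul, abs_mul]
    exact mul_le_mul_of_nonneg_left (hC ω) (abs_nonneg a)

/-- The σ-algebra generated by the functions in `M`. -/
abbrev sigmaGenerated (M : Submodule ℝ (Ω → ℝ)) : MeasurableSpace Ω :=
  ⨆ X ∈ M, MeasurableSpace.comap X (borel ℝ)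

/-- A linear space of functions that is closed under pointwise minima
(equivalently, under pointwise maxima). -/
def IsRieszSubspace (M : Submodule ℝ (Ω → ℝ)) : Prop :=
  ∀ X ∈ M, ∀ Y ∈ M, X ⊓ Y ∈ M

/-- Monotone and constant preserving functionals. An *expectation* is a pre-expectation on
`LInfty Ω`. -/
structure IsPreExpectation {D : Submodule ℝ (Ω → ℝ)} (E : D → ℝ) : Prop where
  mono : ∀ X Y : D, X ≤ Y → E X ≤ E Y
  const : ∀ (a : ℝ) (h : (fun _ : Ω => a) ∈ D), E ⟨fun _ => a, h⟩ = a

/-- `E(Xₙ) ↘ E(X)` whenever `Xₙ ↘ X` pointwise with all `Xₙ` and `X` in `S`. -/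
def ContinuousFromAboveOn {D : Submodule ℝ (Ω → ℝ)} (E : D → ℝ) (S : Set (Ω → ℝ)) : Prop :=
  ∀ (Xs : ℕ → D) (X : D), (∀ n, (Xs n : Ω → ℝ) ∈ S) → (X : Ω → ℝ) ∈ S → Antitone Xs →
    (∀ ω, Tendsto (fun n => (Xs n : Ω → ℝ) ω) atTop (𝓝 ((X : Ω → ℝ) ω))) →
    Antitone (fun n => E (Xs n)) ∧ Tendsto (fun n => E (Xs n)) atTop (𝓝 (E X))

/-- Continuity from above on the whole domain. -/
def ContinuousFromAbove {D : Submodule ℝ (Ω → ℝ)} (E : D → ℝ) : Prop :=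
  ContinuousFromAboveOn E (D : Set (Ω → ℝ))

/-- `E(Xₙ) ↗ E(X)` whenever `Xₙ ↗ X` pointwise, on the whole domain. -/
def ContinuousFromBelow {D : Submodule ℝ (Ω → ℝ)} (E : D → ℝ) : Prop :=
  ∀ (Xs : ℕ → D) (X : D), Monotone Xs →
    (∀ ω, Tendsto (fun n => (Xs n : Ω → ℝ) ω) atTop (𝓝 ((X : Ω → ℝ) ω))) →
    Monotone (fun n => E (Xs n)) ∧ Tendsto (fun n => E (Xs n)) atTop (𝓝 (E X))

/-- `M_δ`: the bounded functions that are pointwise limits of decreasing sequences in `M`. -/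
def deltaSet (M : Submodule ℝ (Ω → ℝ)) : Set (Ω → ℝ) :=
  {X | IsBoundedFun X ∧ ∃ Xs : ℕ → M, Antitone Xs ∧
    ∀ ω, Tendsto (fun n => (Xs n : Ω → ℝ) ω) atTop (𝓝 (X ω))}

/-- `M_δ` consists of bounded measurable functions. -/
theorem deltaSet_subset [MeasurableSpace Ω] {M : Submodule ℝ (Ω → ℝ)} (hM : M ≤ LInfty Ω) :
    deltaSet M ⊆ (LInfty Ω : Set (Ω → ℝ)) := by
  rintro X ⟨hb, Xs, -, hlim⟩
  exact ⟨measurable_of_tendsto_metrizable (fun n => (hM (Xs n).2).1) (tendsto_pi_nhds.2 hlim), hb⟩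

/-- The supremum norm. -/
def supNorm (X : Ω → ℝ) : ℝ := ⨆ ω, |X ω|

/-- The topological dual `M'` of a space `M` of bounded functions with the supremum norm:
the linear functionals on `M` that are bounded with respect to that norm. -/
def supDual (M : Submodule ℝ (Ω → ℝ)) : Set (M →ₗ[ℝ] ℝ) :=
  {μ | ∃ C : ℝ, ∀ X : M, |μ X| ≤ C * supNorm (X : Ω → ℝ)}

/-- The conjugate `E^*(μ) = sup_{X ∈ D} (μ X - E X)`, with values in `[-∞, ∞]`. -/
def conjugate {D : Submodule ℝ (Ω → ℝ)} (E : D → ℝ) (μ : D →ₗ[ℝ] ℝ) : EReal :=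
  ⨆ X : D, ((μ X - E X : ℝ) : EReal)

theorem integrable_of_mem_LInfty [MeasurableSpace Ω] (ν : ProbabilityMeasure Ω)
    (X : LInfty Ω) : Integrable (X : Ω → ℝ) (ν : Measure Ω) := by
  obtain ⟨hX, C, hC⟩ := X.2
  exact Integrable.of_bound hX.aestronglyMeasurable C (Eventually.of_forall hC)

/-- The linear functional `X ↦ ν X = ∫ X dν` on the bounded measurable functions. -/
def integralFunctional [MeasurableSpace Ω] (ν : ProbabilityMeasure Ω) : LInfty Ω →ₗ[ℝ] ℝ where
  toFun X := ∫ ω, (X : Ω → ℝ) ω ∂(ν : Measure Ω)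
  map_add' X Y :=
    integral_add (integrable_of_mem_LInfty ν X) (integrable_of_mem_LInfty ν Y)
  map_smul' a X := integral_const_mul a (X : Ω → ℝ)

/-- The functional `Ē(X)`: the supremum of `inf_n E(Xₙ)` over all decreasing sequences `(Xₙ)`
in `M` with `X ≥ inf_n Xₙ` pointwise. All infima and the supremum are taken in `[-∞, ∞]`. -/
def barExtension {M : Submodule ℝ (Ω → ℝ)} (E : M → ℝ) (X : Ω → ℝ) : EReal :=
  sSup {a : EReal | ∃ Xs : ℕ → M, Antitone Xs ∧
    (∀ ω, (⨅ n, (((Xs n : Ω → ℝ) ω : ℝ) : EReal)) ≤ (X ω : EReal)) ∧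
    a = ⨅ n, (E (Xs n) : EReal)}

/-- `(Ω, F, E)` is a convex expectation space: `E` is a convex expectation on the bounded
measurable functions and, for some set `P` of probability measures,
`E(X) = sup_{μ ∈ P} (μ X - E^*(μ))` for all `X`. -/
structure IsConvexExpectationSpace [MeasurableSpace Ω] (E : LInfty Ω → ℝ) : Prop where
  isExpectation : IsPreExpectation E
  convex : ConvexOn ℝ Set.univ E
  representation : ∃ P : Set (ProbabilityMeasure Ω), ∀ X : LInfty Ω,
    (E X : EReal) =
      ⨆ μ ∈ P, ((integralFunctional μ X : ℝ) : EReal) - conjugate E (integralFunctional μ)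

end NonlinearExpectation

end

noncomputable section

namespace NonlinearExpectation

variable {Ω : Type*}

/-! ### Riesz subspaces -/

/-! Two mechanisms meet: capacitability, which reaches every measurable function from below through
`M`, and convex duality, which reduces `E` to probability measures.

Every bounded measurable $X$ is a Suslin function $\sup_\sigma\inf_n g_n^\sigma$ over `M`
(`isSuslin_of_mem_LInfty`). Choquet's argument (`exists_antitone_of_lt`) then shows that a monotone
$F$ that is continuous from below admits, for each $c<F(X)$, a decreasing sequence $(Y_n)$ in `M`
with $\inf_n Y_n\le X$ and $F(Y_n)\ge c$. If $F$ is also continuous from above on $M_\delta$, it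
equals the bar extension of its restriction to `M` (`barExtension_comp_inclusion`). This gives
uniqueness, and it applies to integrals as well.

For duality, let $(Y_n)$ in `M` decrease and be bounded below. A subgradient at $0$ of the convex
function $X\mapsto\inf_n E(Y_n+X)$ is one $\mu$ with $\mu Y_m-E^*(\mu)\ge\inf_n E(Y_n)$ for all $m$.
Finiteness of $E^*(\mu)$ and continuity from above make $\mu$ an integral (Daniell–Stone). Hence
$\bar E(X)\le\sup_\nu(\nu X-E^*(\nu|_M))$; the converse is Choquet's theorem for $\nu$. A supremum
of affine functionals continuous from below is convex and continuous from below. Continuity from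
above on $M_\delta$ follows from a diagonal sequence. -/

theorem const_mem {M : Submodule ℝ (Ω → ℝ)} (hone : (1 : Ω → ℝ) ∈ M) (a : ℝ) :
    (fun _ : Ω => a) ∈ M := by
  convert M.smul_mem a hone using 1
  ext; simp

theorem IsRieszSubspace.sup_mem {M : Submodule ℝ (Ω → ℝ)} (hR : IsRieszSubspace M) {X Y : Ω → ℝ}
    (hX : X ∈ M) (hY : Y ∈ M) : X ⊔ Y ∈ M := by
  have h := M.neg_mem (hR _ (M.neg_mem hX) _ (M.neg_mem hY))
  rwa [← neg_sup, neg_neg] at h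

/-! ### Suslin functions -/

/-- `X = sup_σ inf_n g n σ`, where `g n σ ∈ M` depends only on the first `n` terms of the
sequence `σ`. -/
def IsSuslin (M : Submodule ℝ (Ω → ℝ)) (X : Ω → ℝ) : Prop :=
  ∃ g : ℕ → (ℕ → ℕ) → Ω → ℝ, (∀ n σ, g n σ ∈ M) ∧
    (∀ n σ τ, (∀ i < n, σ i = τ i) → g n σ = g n τ) ∧
    (∀ ω σ a, (∀ n, a ≤ g n σ ω) → a ≤ X ω) ∧
    (∀ ω a, a < X ω → ∃ σ, ∀ n, a ≤ g n σ ω)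

theorem IsSuslin.of_mem {M : Submodule ℝ (Ω → ℝ)} {X : Ω → ℝ} (hX : X ∈ M) : IsSuslin M X :=
  ⟨fun _ _ => X, fun _ _ => hX, fun _ _ _ _ => rfl, fun _ _ _ h => h 0,
    fun _ _ h => ⟨0, fun _ => h.le⟩⟩

/-- One sequence codes a sequence of sequences through `Nat.pair`, and stage $m=\langle j,n\rangle$
performs the $n$-th test for $X_j$. -/
theorem IsSuslin.iInf {M : Submodule ℝ (Ω → ℝ)} {X : ℕ → Ω → ℝ} (hX : ∀ j, IsSuslin M (X j))
    {Y : Ω → ℝ} (hY : ∀ ω, IsGLB (Set.range fun j => X j ω) (Y ω)) : IsSuslin M Y := by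
  choose g hgM hgd hg1 hg2 using hX
  refine ⟨fun m σ => g m.unpair.1 m.unpair.2 fun i => σ (Nat.pair m.unpair.1 i),
    fun _ _ => hgM _ _ _, fun m σ τ h => hgd _ _ _ _ fun i hi => h _ ?_, fun ω σ a h => ?_,
    fun ω a h => ?_⟩
  -- The entries read at stage $\langle j,n\rangle$ have indices $\langle j,i\rangle$ with $i<n$,
  -- all below $\langle j,n\rangle$.
  · calc _ < Nat.pair m.unpair.1 m.unpair.2 := Nat.pair_lt_pair_right _ hi
      _ = m := Nat.pair_unpair m
  · refine (le_isGLB_iff (hY ω)).2 ?_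
    rintro _ ⟨j, rfl⟩
    refine hg1 j ω (fun i => σ (Nat.pair j i)) a fun n => ?_
    simpa using h (Nat.pair j n)
  · have h' : ∀ j, ∃ σ, ∀ n, a ≤ g j n σ ω := fun j =>
      hg2 j ω a (h.trans_le ((hY ω).1 ⟨j, rfl⟩))
    choose σ hσ using h'
    refine ⟨fun m => σ m.unpair.1 m.unpair.2, fun m => ?_⟩
    simpa using hσ m.unpair.1 m.unpair.2

/-- The first entry of the sequence selects $j$ and the rest serves $X_j$. Stage $0$ must not depend
on the sequence at all, so it is the harmless constant $C$. -/
theorem IsSuslin.iSup {M : Submodule ℝ (Ω → ℝ)} (hone : (1 : Ω → ℝ) ∈ M) {X : ℕ → Ω → ℝ}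
    (hX : ∀ j, IsSuslin M (X j)) {Y : Ω → ℝ}
    (hY : ∀ ω, IsLUB (Set.range fun j => X j ω) (Y ω)) {C : ℝ} (hC : ∀ ω, Y ω ≤ C) :
    IsSuslin M Y := by
  choose g hgM hgd hg1 hg2 using hX
  refine ⟨fun m σ => Nat.casesOn m (fun _ => C) fun n => g (σ 0) n fun i => σ (i + 1),
    fun m σ => ?_, fun m σ τ h => ?_, fun ω σ a h => ?_, fun ω a h => ?_⟩
  · cases m with
    | zero => exact const_mem hone C
    | succ n => exact hgM _ _ _
  · cases m with
    | zero => rfl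
    | succ n =>
      have h0 : σ 0 = τ 0 := h 0 n.succ_pos
      simp only [h0]
      exact hgd _ _ _ _ fun i hi => h _ (by omega)
  · exact (hg1 (σ 0) ω _ a fun n => h (n + 1)).trans ((hY ω).1 ⟨σ 0, rfl⟩)
  · obtain ⟨_, ⟨j, rfl⟩, hj⟩ := (lt_isLUB_iff (hY ω)).1 h
    obtain ⟨σ, hσ⟩ := hg2 j ω a hj
    refine ⟨fun i => Nat.casesOn i j σ, fun m => ?_⟩
    cases m with
    | zero => exact h.le.trans (hC ω)
    | succ n => exact hσ n

open Classical in
/-- The function with value `d` on `A` and `c` off `A`. -/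
def twoValued (A : Set Ω) (c d : ℝ) (ω : Ω) : ℝ := if ω ∈ A then d else c

theorem twoValued_of_mem {A : Set Ω} {ω : Ω} (h : ω ∈ A) (c d : ℝ) : twoValued A c d ω = d :=
  if_pos h

theorem twoValued_of_notMem {A : Set Ω} {ω : Ω} (h : ω ∉ A) (c d : ℝ) : twoValued A c d ω = c :=
  if_neg h

theorem isLUB_twoValued_iUnion (A : ℕ → Set Ω) {c d : ℝ} (hcd : c ≤ d) (ω : Ω) :
    IsLUB (Set.range fun j => twoValued (A j) c d ω) (twoValued (⋃ j, A j) c d ω) := by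
  by_cases h : ω ∈ ⋃ j, A j
  · rw [twoValued_of_mem h]
    obtain ⟨j, hj⟩ := Set.mem_iUnion.1 h
    refine IsGreatest.isLUB ⟨⟨j, twoValued_of_mem hj _ _⟩, ?_⟩
    rintro _ ⟨i, rfl⟩
    by_cases hi : ω ∈ A i
    · simp [twoValued_of_mem hi]
    · simpa [twoValued_of_notMem hi]
  · rw [twoValued_of_notMem h]
    have h' : ∀ j, ω ∉ A j := by simpa using h
    simp [twoValued_of_notMem (h' _)]

theorem isGLB_twoValued_compl_iUnion (A : ℕ → Set Ω) {c d : ℝ} (hcd : c ≤ d) (ω : Ω) :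
    IsGLB (Set.range fun j => twoValued (A j)ᶜ c d ω) (twoValued (⋃ j, A j)ᶜ c d ω) := by
  by_cases h : ω ∈ ⋃ j, A j
  · rw [twoValued_of_notMem (by simpa using h)]
    obtain ⟨j, hj⟩ := Set.mem_iUnion.1 h
    refine IsLeast.isGLB ⟨⟨j, twoValued_of_notMem (by simpa using hj) _ _⟩, ?_⟩
    rintro _ ⟨i, rfl⟩
    by_cases hi : ω ∈ (A i)ᶜ
    · simpa [twoValued_of_mem hi]
    · simp [twoValued_of_notMem hi]
  · rw [twoValued_of_mem h]
    have h' : ∀ j, ω ∈ (A j)ᶜ := by simpa using h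
    simp [twoValued_of_mem (h' _)]

theorem isSuslin_twoValued_Ioi {M : Submodule ℝ (Ω → ℝ)} (hone : (1 : Ω → ℝ) ∈ M)
    (hR : IsRieszSubspace M) {X : Ω → ℝ} (hX : X ∈ M) (a : ℝ) {c d : ℝ} (hcd : c ≤ d) :
    IsSuslin M (twoValued (X ⁻¹' Set.Ioi a) c d) := by
  -- Ramps of slope $n$ in $X-a$, clipped to $[c,d]$: they equal $c$ where $X\le a$ and eventually
  -- equal $d$ where $X>a$.
  set f : ℕ → Ω → ℝ := fun n =>
    (fun _ => d) ⊓ ((fun _ => c) ⊔ ((fun _ => c) + (n : ℝ) • (X - fun _ => a))) with hf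
  have hfM : ∀ n, f n ∈ M := fun n =>
    hR _ (const_mem hone _) _ (hR.sup_mem (const_mem hone _)
      (M.add_mem (const_mem hone _) (M.smul_mem _ (M.sub_mem hX (const_mem hone _)))))
  refine IsSuslin.iSup hone (fun n => IsSuslin.of_mem (hfM n)) (C := d) (fun ω => ?_) (fun ω => ?_)
  · by_cases h : ω ∈ X ⁻¹' Set.Ioi a
    · rw [twoValued_of_mem h]
      have h' : 0 < X ω - a := sub_pos.2 h
      obtain ⟨n, hn⟩ := exists_nat_ge ((d - c) / (X ω - a))
      rw [div_le_iff₀ h'] at hn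
      refine IsGreatest.isLUB ⟨⟨n, ?_⟩, ?_⟩
      · simp only [hf, Pi.inf_apply, Pi.sup_apply, Pi.add_apply, Pi.smul_apply, Pi.sub_apply,
          smul_eq_mul]
        exact inf_of_le_left (le_sup_of_le_right (by linarith))
      · rintro _ ⟨i, rfl⟩
        exact inf_le_left
    · rw [twoValued_of_notMem h]
      have h' : X ω - a ≤ 0 := by simpa using h
      have : ∀ n, f n ω = c := fun n => by
        simp only [hf, Pi.inf_apply, Pi.sup_apply, Pi.add_apply, Pi.smul_apply, Pi.sub_apply,
          smul_eq_mul]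
        rw [sup_of_le_left, inf_of_le_right hcd]
        have := mul_nonpos_of_nonneg_of_nonpos n.cast_nonneg h'
        linarith
      simp [this]
  · by_cases h : ω ∈ X ⁻¹' Set.Ioi a
    · rw [twoValued_of_mem h]
    · rwa [twoValued_of_notMem h]

theorem isSuslin_twoValued_compl_Ioi {M : Submodule ℝ (Ω → ℝ)} (hone : (1 : Ω → ℝ) ∈ M)
    (hR : IsRieszSubspace M) {X : Ω → ℝ} (hX : X ∈ M) (a : ℝ) {c d : ℝ} (hcd : c ≤ d) :
    IsSuslin M (twoValued (X ⁻¹' Set.Ioi a)ᶜ c d) := by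
  have e : (X ⁻¹' Set.Ioi a)ᶜ = ⋂ n : ℕ, (-X) ⁻¹' Set.Ioi (-a - 1 / (n + 1)) := by
    ext ω
    simp only [Set.mem_compl_iff, Set.mem_preimage, Set.mem_Ioi, not_lt, Set.mem_iInter,
      Pi.neg_apply]
    refine ⟨fun h n => ?_, fun h => ?_⟩
    · have : (0 : ℝ) < 1 / (n + 1) := by positivity
      linarith
    · refine le_of_forall_pos_le_add fun ε hε => ?_
      obtain ⟨n, hn⟩ := exists_nat_one_div_lt hε
      linarith [h n]
  refine IsSuslin.iInf
    (fun n => isSuslin_twoValued_Ioi hone hR (M.neg_mem hX) (-a - 1 / (n + 1)) hcd) fun ω => ?_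
  have := isGLB_twoValued_compl_iUnion (fun n : ℕ => ((-X) ⁻¹' Set.Ioi (-a - 1 / (n + 1)))ᶜ) hcd ω
  simpa only [compl_compl, e, Set.compl_iUnion] using this

theorem isSuslin_twoValued [mΩ : MeasurableSpace Ω] {M : Submodule ℝ (Ω → ℝ)}
    (hone : (1 : Ω → ℝ) ∈ M) (hR : IsRieszSubspace M) (hσ : mΩ = sigmaGenerated M)
    {A : Set Ω} (hA : MeasurableSet A) {c d : ℝ} (hcd : c ≤ d) :
    IsSuslin M (twoValued A c d) := by
  have hle : ∀ B : Set Ω, ∀ ω, twoValued B c d ω ≤ d := fun B ω => by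
    by_cases h : ω ∈ B
    · rw [twoValued_of_mem h]
    · rwa [twoValued_of_notMem h]
  -- Suslin functions are not stable under complementation, so the good sets are those for which
  -- both the set and its complement qualify.
  let m' : MeasurableSpace Ω :=
    { MeasurableSet' := fun A => IsSuslin M (twoValued A c d) ∧ IsSuslin M (twoValued Aᶜ c d)
      measurableSet_empty := by
        have h1 : twoValued (∅ : Set Ω) c d = fun _ => c := funext fun ω =>
          twoValued_of_notMem (Set.notMem_empty ω) _ _
        have h2 : twoValued (∅ : Set Ω)ᶜ c d = fun _ => d := funext fun ω =>
          twoValued_of_mem (Set.notMem_empty ω) _ _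
        rw [h1, h2]
        exact ⟨IsSuslin.of_mem (const_mem hone c), IsSuslin.of_mem (const_mem hone d)⟩
      measurableSet_compl := fun A h => ⟨h.2, by rw [compl_compl]; exact h.1⟩
      measurableSet_iUnion := fun A h =>
        ⟨IsSuslin.iSup hone (fun j => (h j).1) (isLUB_twoValued_iUnion A hcd) (hle _),
          IsSuslin.iInf (fun j => (h j).2) (isGLB_twoValued_compl_iUnion A hcd)⟩ }
  have hm : mΩ ≤ m' := by
    rw [hσ]
    refine iSup₂_le fun X hX => ?_
    have : @Measurable Ω ℝ m' _ X := by
      refine measurable_of_Ioi fun a => ?_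
      exact ⟨isSuslin_twoValued_Ioi hone hR hX a hcd, isSuslin_twoValued_compl_Ioi hone hR hX a hcd⟩
    have h2 := this.comap_le
    rwa [BorelSpace.measurable_eq (α := ℝ)] at h2
  exact (hm A hA).1

/-- $X$ is the countable supremum of two-valued functions jumping from $-C$ to a level $q$ on
$\{X>q\}$. Rational levels are raised to at least $-C$ so that the jump goes upwards. -/
theorem isSuslin_of_mem_LInfty [mΩ : MeasurableSpace Ω] {M : Submodule ℝ (Ω → ℝ)}
    (hone : (1 : Ω → ℝ) ∈ M) (hR : IsRieszSubspace M) (hσ : mΩ = sigmaGenerated M)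
    {X : Ω → ℝ} (hX : X ∈ LInfty Ω) : IsSuslin M X := by
  obtain ⟨hm, C, hC⟩ := hX
  obtain ⟨r, hr⟩ := exists_surjective_nat ℚ
  have hn : ∀ ω, -C ≤ X ω := fun ω => (abs_le.1 (hC ω)).1
  refine IsSuslin.iSup hone
    (X := fun n => twoValued (X ⁻¹' Set.Ioi (max (r n : ℝ) (-C))) (-C) (max (r n : ℝ) (-C)))
    (fun n => isSuslin_twoValued hone hR hσ (hm measurableSet_Ioi) (le_max_right _ _))
    (fun ω => ⟨?_, fun b hb => ?_⟩) (fun ω => (abs_le.1 (hC ω)).2)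
  · rintro _ ⟨n, rfl⟩
    by_cases h : ω ∈ X ⁻¹' Set.Ioi (max (r n : ℝ) (-C))
    · simp only [twoValued_of_mem h]
      exact le_of_lt h
    · simp only [twoValued_of_notMem h]
      exact hn ω
  · by_contra! hlt
    obtain ⟨q, hq1, hq2⟩ := exists_rat_btwn hlt
    obtain ⟨n, rfl⟩ := hr q
    have h := hb ⟨n, rfl⟩
    by_cases hmem : ω ∈ X ⁻¹' Set.Ioi (max (r n : ℝ) (-C))
    · simp only [twoValued_of_mem hmem] at h
      exact absurd ((le_max_left _ _).trans h) (not_le.2 hq1)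
    · simp only [twoValued_of_notMem hmem] at h
      have : X ω ≤ max (r n : ℝ) (-C) := not_lt.1 hmem
      rcases le_max_iff.1 this with h' | h'
      · exact absurd h' (not_le.2 hq2)
      · linarith

/-! ### Choquet's capacitability theorem -/

/-- Below `h` there are only finitely many initial segments of length `k`, so the supremum is a
finite maximum: it stays in `M` and is attained. -/
theorem exists_sup_of_dependsOn_initial {M : Submodule ℝ (Ω → ℝ)} (hR : IsRieszSubspace M)
    (h : ℕ → ℕ) (k : ℕ) {φ : (ℕ → ℕ) → Ω → ℝ} (hφM : ∀ σ, φ σ ∈ M)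
    (hφ : ∀ σ τ, (∀ i < k, σ i = τ i) → φ σ = φ τ) :
    ∃ Y ∈ M, ∀ ω, (∀ σ, (∀ i < k, σ i ≤ h i) → φ σ ω ≤ Y ω) ∧
      ∃ σ, (∀ i, σ i ≤ h i) ∧ φ σ ω = Y ω := by
  set ext : (Fin k → ℕ) → ℕ → ℕ := fun τ i => if hi : i < k then τ ⟨i, hi⟩ else 0 with hext
  set s : Finset (Fin k → ℕ) := Finset.Iic fun i => h i with hs
  have hne : s.Nonempty := ⟨fun i => h i, by simp [hs]⟩
  refine ⟨s.sup' hne fun τ => φ (ext τ),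
    Finset.sup'_mem (M : Set (Ω → ℝ)) (fun _ hx _ hy => hR.sup_mem hx hy) _ _ _ fun τ _ => hφM _,
    fun ω => ⟨fun σ hσ => ?_, ?_⟩⟩
  · rw [Finset.sup'_apply, hφ σ (ext fun i => σ i) fun i hi => by simp [hext, hi]]
    exact Finset.le_sup' (fun τ => φ (ext τ) ω) (Finset.mem_Iic.2 fun i => hσ _ i.2)
  · rw [Finset.sup'_apply]
    obtain ⟨τ, hτ, he⟩ := Finset.exists_mem_eq_sup' hne fun τ => φ (ext τ) ω
    refine ⟨ext τ, fun i => ?_, he.symm⟩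
    by_cases hi : i < k
    · simp only [hext, hi, dif_pos]
      exact (Finset.mem_Iic.1 hτ) ⟨i, hi⟩
    · simp [hext, hi]

theorem isClosed_of_dependsOn_initial (n : ℕ) {P : (ℕ → ℕ) → Prop}
    (hP : ∀ σ τ, (∀ i < n, σ i = τ i) → P σ → P τ) : IsClosed {σ | P σ} := by
  have : {σ | P σ} = (fun (σ : ℕ → ℕ) (i : Fin n) => σ i) ⁻¹'
      ((fun (σ : ℕ → ℕ) (i : Fin n) => σ i) '' {σ | P σ}) := by
    refine subset_antisymm (Set.subset_preimage_image _ _) ?_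
    rintro τ ⟨σ, hσ, he⟩
    exact hP σ τ (fun i hi => congrFun he ⟨i, hi⟩) hσ
  rw [this]
  exact (isClosed_discrete _).preimage (by fun_prop)

/-- The functional `F` stays above some `c' > c` on all functions that are at least `-C` and
majorize, at each `ω`, all numbers `a` with `R σ ω a` for some `σ ∈ S`. -/
def HasGap [MeasurableSpace Ω] {ι : Type*} (F : LInfty Ω → ℝ) (R : ι → Ω → ℝ → Prop) (C c : ℝ)
    (S : Set ι) : Prop :=
  ∃ c' > c, ∀ W : LInfty Ω, (∀ ω, -C ≤ (W : Ω → ℝ) ω) →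
    (∀ σ ∈ S, ∀ ω a, R σ ω a → a ≤ (W : Ω → ℝ) ω) → c' ≤ F W

/-- Continuity from below of the outer capacity. Measurable majorants stand in for envelopes over
uncountable sets, which need not be measurable. If every `S m` fails, tail infima of cheap majorants
increase to a cheap majorant for the union. -/
theorem exists_hasGap_of_iUnion [MeasurableSpace Ω] {ι : Type*} {F : LInfty Ω → ℝ}
    (hmono : ∀ X Y, X ≤ Y → F X ≤ F Y) (hF : ContinuousFromBelow F) {R : ι → Ω → ℝ → Prop}
    {C c : ℝ} (hRC : ∀ σ ω a, R σ ω a → a ≤ C) (hC : -C ≤ C) {S : ℕ → Set ι} (hS : Monotone S)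
    (hgap : HasGap F R C c (⋃ m, S m)) : ∃ m, HasGap F R C c (S m) := by
  by_contra! hno
  obtain ⟨c', hc', hgap⟩ := hgap
  -- The midpoint is still a strict gap above `c`, yet lies strictly below `c'`.
  have hW : ∀ m, ∃ W : LInfty Ω, (∀ ω, -C ≤ (W : Ω → ℝ) ω) ∧
      (∀ σ ∈ S m, ∀ ω a, R σ ω a → a ≤ (W : Ω → ℝ) ω) ∧ F W < (c + c') / 2 := by
    intro m
    by_contra! h
    exact hno m ⟨(c + c') / 2, by linarith, h⟩
  choose W hWC hWS hWF using hW
  set V : ℕ → Ω → ℝ := fun m ω => ⨅ k, min ((W (m + k) : Ω → ℝ) ω) C with hV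
  have hmin : ∀ m ω, -C ≤ min ((W m : Ω → ℝ) ω) C := fun m ω => le_min (hWC m ω) hC
  have hbdd : ∀ m ω, BddBelow (Set.range fun k => min ((W (m + k) : Ω → ℝ) ω) C) := fun m ω =>
    ⟨-C, by rintro _ ⟨k, rfl⟩; exact hmin _ _⟩
  have hVC : ∀ m ω, V m ω ≤ C := fun m ω => (ciInf_le (hbdd m ω) 0).trans (min_le_right _ _)
  have hVC' : ∀ m ω, -C ≤ V m ω := fun m ω => le_ciInf fun k => hmin _ _
  have hVm : ∀ m, Measurable (V m) := fun m =>
    Measurable.iInf fun k => (W (m + k)).2.1.min measurable_const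
  have hVmono : Monotone V := by
    refine monotone_nat_of_le_succ fun m ω => le_ciInf fun k => ?_
    have := ciInf_le (hbdd m ω) (k + 1)
    rwa [show m + (k + 1) = m + 1 + k by ring] at this
  have hVle : ∀ m, V m ≤ W m := fun m ω =>
    (ciInf_le (hbdd m ω) 0).trans (min_le_left _ _)
  have hbdd' : ∀ ω, BddAbove (Set.range fun m => V m ω) := fun ω =>
    ⟨C, by rintro _ ⟨m, rfl⟩; exact hVC m ω⟩
  set U : Ω → ℝ := fun ω => ⨆ m, V m ω with hU
  have hUV : ∀ m, V m ≤ U := fun m ω => le_ciSup (hbdd' ω) m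
  have hUm : U ∈ LInfty Ω := ⟨Measurable.iSup hVm, C, fun ω => abs_le.2
    ⟨(hVC' 0 ω).trans (hUV 0 ω), ciSup_le fun m => hVC m ω⟩⟩
  have hlim := (hF (fun m => ⟨V m, hVm m, C, fun ω => abs_le.2 ⟨hVC' m ω, hVC m ω⟩⟩) ⟨U, hUm⟩
    (fun m n h => hVmono h) fun ω => tendsto_atTop_ciSup (fun m n h => hVmono h ω) (hbdd' ω)).2
  have h1 : F ⟨U, hUm⟩ ≤ (c + c') / 2 :=
    le_of_tendsto' hlim fun m => (hmono _ _ (hVle m)).trans (hWF m).le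
  have h2 : c' ≤ F ⟨U, hUm⟩ := by
    refine hgap _ (fun ω => (hVC' 0 ω).trans (hUV 0 ω)) fun σ hσ ω a ha => ?_
    obtain ⟨m, hm⟩ := Set.mem_iUnion.1 hσ
    exact (le_ciInf fun k => le_min (hWS _ σ (hS (Nat.le_add_right m k) hm) ω a ha)
      (hRC σ ω a ha)).trans (hUV m ω)
  linarith

/-- The entries of $\sigma$ are bounded one at a time by some `h`, keeping the capacity above `c`.
The maxima over $\sigma\le h$ of the first tests form the sequence, and compactness of $\{\sigma\le
h\}$ keeps its infimum below $X$. -/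
theorem exists_antitone_of_lt [mΩ : MeasurableSpace Ω] {M : Submodule ℝ (Ω → ℝ)}
    (hM : M ≤ LInfty Ω) (hone : (1 : Ω → ℝ) ∈ M) (hR : IsRieszSubspace M)
    (hσ : mΩ = sigmaGenerated M) {F : LInfty Ω → ℝ} (hmono : ∀ X Y, X ≤ Y → F X ≤ F Y)
    (hF : ContinuousFromBelow F) (X : LInfty Ω) {c : ℝ} (hc : c < F X) :
    ∃ Ys : ℕ → M, Antitone Ys ∧
      (∀ ω a, (∀ n, a ≤ (Ys n : Ω → ℝ) ω) → a ≤ (X : Ω → ℝ) ω) ∧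
      ∀ n, c ≤ F (Submodule.inclusion hM (Ys n)) := by
  obtain ⟨-, C₀, hC₀⟩ := id X.2
  obtain ⟨C, hC0, hCX⟩ : ∃ C : ℝ, 0 ≤ C ∧ ∀ ω, |(X : Ω → ℝ) ω| ≤ C :=
    ⟨max C₀ 0, le_max_right _ _, fun ω => (hC₀ ω).trans (le_max_left _ _)⟩
  obtain ⟨g, hgM, hgd, hg1, hg2⟩ := isSuslin_of_mem_LInfty hone hR hσ X.2
  set R : (ℕ → ℕ) → Ω → ℝ → Prop := fun σ ω a => ∀ n, a ≤ g n σ ω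
  have huniv : HasGap F R C c Set.univ := by
    refine ⟨F X, hc, fun W _ hW => hmono _ _ fun ω => ?_⟩
    refine le_of_forall_lt fun a ha => ?_
    obtain ⟨b, hab, hb⟩ := exists_between ha
    obtain ⟨σ, hσ⟩ := hg2 ω b hb
    exact hab.trans_le (hW σ (Set.mem_univ _) ω b hσ)
  -- The implication sits inside the existential so that `choose` gives a bound for every `S` and
  -- the recursion for `T` needs no proofs.
  have hstep : ∀ (S : Set (ℕ → ℕ)) (k : ℕ), ∃ m, HasGap F R C c S →
      HasGap F R C c (S ∩ {σ | σ k ≤ m}) := by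
    intro S k
    by_cases hS : HasGap F R C c S
    · have hU : (⋃ m, S ∩ {σ | σ k ≤ m}) = S := by
        rw [← Set.inter_iUnion]
        refine Set.inter_eq_left.2 fun σ _ => Set.mem_iUnion.2 ⟨σ k, le_refl (σ k)⟩
      obtain ⟨m, hm⟩ := exists_hasGap_of_iUnion hmono hF (R := R) (C := C)
        (S := fun m => S ∩ {σ | σ k ≤ m})
        (fun σ ω a ha => (hg1 ω σ a ha).trans (abs_le.1 (hCX ω)).2) (by linarith)
        (fun m n hmn σ hσ => ⟨hσ.1, le_trans hσ.2 hmn⟩) (by rwa [hU])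
      exact ⟨m, fun _ => hm⟩
    · exact ⟨0, fun h => absurd h hS⟩
  choose m hm using hstep
  set T : ℕ → Set (ℕ → ℕ) := fun k =>
    Nat.rec Set.univ (fun k S => S ∩ {σ | σ k ≤ m S k}) k
  have hTgap : ∀ k, HasGap F R C c (T k) := by
    intro k
    induction k with
    | zero => exact huniv
    | succ k ih => exact hm _ k ih
  set h : ℕ → ℕ := fun k => m (T k) k with hh
  have hTmem : ∀ k σ, σ ∈ T k → ∀ i < k, σ i ≤ h i := by
    intro k
    induction k with
    | zero => intro σ _ i hi; omega
    | succ k ih =>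
      intro σ hσ i hi
      rcases Nat.lt_succ_iff_lt_or_eq.1 hi with hi | rfl
      · exact ih σ hσ.1 i hi
      · exact hσ.2
  set φ : ℕ → (ℕ → ℕ) → Ω → ℝ := fun k σ =>
    (Finset.range (k + 1)).inf' Finset.nonempty_range_add_one fun n => g n σ with hφ
  have hφM : ∀ k σ, φ k σ ∈ M := fun k σ =>
    Finset.inf'_mem (M : Set (Ω → ℝ)) (fun x hx y hy => hR x hx y hy) _ _ _ fun n _ => hgM n σ
  have hφle : ∀ k σ ω a, a ≤ φ k σ ω ↔ ∀ n ≤ k, a ≤ g n σ ω := by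
    intro k σ ω a
    simp only [hφ]
    rw [Finset.inf'_apply, Finset.le_inf'_iff]
    simp
  have hφd : ∀ k σ τ, (∀ i < k, σ i = τ i) → φ k σ = φ k τ := by
    intro k σ τ hστ
    refine Finset.inf'_congr _ rfl fun n hn => hgd n σ τ fun i hi => hστ i ?_
    exact hi.trans_le (Nat.lt_succ_iff.1 (Finset.mem_range.1 hn))
  have hY := fun k => exists_sup_of_dependsOn_initial hR h k (hφM k) (hφd k)
  choose Y hYM hYle hYeq using fun k => hY k
  have hYanti : Antitone Y := by
    refine antitone_nat_of_succ_le fun k ω => ?_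
    obtain ⟨σ, hσ, he⟩ := hYeq (k + 1) ω
    rw [← he]
    refine le_trans ?_ (hYle k ω σ fun i _ => hσ i)
    exact (hφle k σ ω _).2 fun n hn => (hφle (k + 1) σ ω _).1 le_rfl n (hn.trans k.le_succ)
  -- Truncation at $-C$ meets the lower bound in `HasGap` and costs nothing, since $X\ge -C$.
  refine ⟨fun k => ⟨Y k ⊔ fun _ => -C, hR.sup_mem (hYM k) (const_mem hone _)⟩,
    fun k l hkl => sup_le_sup_right (hYanti hkl) _, fun ω a ha => ?_, fun k => ?_⟩
  · by_cases haC : a ≤ -C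
    · exact haC.trans (abs_le.1 (hCX ω)).1
    have haY : ∀ k, a ≤ Y k ω := fun k => (le_max_iff.1 (ha k)).resolve_right haC
    have hcpt : IsCompact (Set.univ.pi fun i => Set.Iic (h i)) :=
      isCompact_univ_pi fun i => (Set.finite_Iic (h i)).isCompact
    have hcl : ∀ k, IsClosed {σ : ℕ → ℕ | a ≤ φ k σ ω} := fun k =>
      isClosed_of_dependsOn_initial k fun σ τ hστ hs => by rwa [← hφd k σ τ hστ]
    -- For each `k` some $\sigma\le h$ passes the tests up to `k`; nested compact sets yield one
    -- $\sigma$ that passes them all.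
    obtain ⟨σ, hσ⟩ := IsCompact.nonempty_iInter_of_sequence_nonempty_isCompact_isClosed
      (fun k => (Set.univ.pi fun i => Set.Iic (h i)) ∩ {σ | a ≤ φ k σ ω})
      (fun k σ hs => ⟨hs.1, (hφle k σ ω a).2 fun n hn =>
        (hφle (k + 1) σ ω a).1 hs.2 n (hn.trans k.le_succ)⟩)
      (fun k => by
        obtain ⟨σ, hs, he⟩ := hYeq k ω
        exact ⟨σ, fun i _ => hs i, (haY k).trans he.ge⟩)
      (hcpt.inter_right (hcl 0)) (fun k => hcpt.isClosed.inter (hcl k))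
    exact hg1 ω σ a fun n => (hφle n σ ω a).1 (Set.mem_iInter.1 hσ n).2 n le_rfl
  · obtain ⟨c', hc', hgap⟩ := hTgap k
    refine hc'.le.trans (hgap _ (fun ω => le_max_right _ _) fun σ hs ω a ha => ?_)
    exact le_trans ((hφle k σ ω a).2 fun n _ => ha n)
      ((hYle k ω σ (hTmem k σ hs)).trans (le_max_left _ _))

/-! ### The Daniell–Stone theorem -/

/-- An increasing sequence of nonnegative functions of `M` with limit at least `1` on `A`, on which
the functional `μ` is at most `r`. -/
def IsDaniellCover {M : Submodule ℝ (Ω → ℝ)} (μ : M →ₗ[ℝ] ℝ) (A : Set Ω) (r : ENNReal) : Prop :=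
  ∃ s : ℕ → M, Monotone s ∧ (∀ n, 0 ≤ s n) ∧ (∀ ω ∈ A, ∀ a < 1, ∃ n, a ≤ (s n : Ω → ℝ) ω) ∧
    ∀ n, ENNReal.ofReal (μ (s n)) ≤ r

/-- The outer measure associated with a positive linear functional on a space of functions. -/
def daniellOuterMeasure {M : Submodule ℝ (Ω → ℝ)} (μ : M →ₗ[ℝ] ℝ) : OuterMeasure Ω where
  measureOf A := sInf {r | IsDaniellCover μ A r}
  empty := le_antisymm (sInf_le ⟨fun _ => 0, monotone_const, fun _ => le_rfl, by simp, by simp⟩)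
    bot_le
  mono := fun h => sInf_le_sInf fun _ ⟨s, h1, h2, h3, h4⟩ =>
    ⟨s, h1, h2, fun ω hω => h3 ω (h hω), h4⟩
  iUnion_nat A _ := by
    refine ENNReal.le_of_forall_pos_le_add fun ε hε hfin => ?_
    obtain ⟨δ, hδ, hδε⟩ := ENNReal.exists_pos_sum_of_countable (ENNReal.coe_pos.2 hε).ne' ℕ
    have hA : ∀ i, ∃ r, IsDaniellCover μ (A i) r ∧
        r < sInf {r | IsDaniellCover μ (A i) r} + δ i := by
      intro i
      have := ENNReal.lt_add_right (ENNReal.ne_top_of_tsum_ne_top hfin.ne i)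
        (ENNReal.coe_pos.2 (hδ i)).ne'
      obtain ⟨r, hr, hlt⟩ := sInf_lt_iff.1 this
      exact ⟨r, hr, hlt⟩
    choose r hr hlt using hA
    choose s hmono hpos hs hμ using hr
    have hcov : IsDaniellCover μ (⋃ i, A i) (∑' i, r i) := by
      refine ⟨fun n => ∑ i ∈ Finset.range n, s i n, ?_, ?_, ?_, ?_⟩
      · refine monotone_nat_of_le_succ fun n => ?_
        rw [Finset.sum_range_succ]
        exact le_add_of_le_of_nonneg (Finset.sum_le_sum fun i _ => hmono i n.le_succ) (hpos _ _)
      · exact fun n => Finset.sum_nonneg fun i _ => hpos i n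
      · intro ω hω a ha
        obtain ⟨i, hi⟩ := Set.mem_iUnion.1 hω
        obtain ⟨n, hn⟩ := hs i ω hi a ha
        -- The index exceeds `i`, so the `i`-th summand is present.
        refine ⟨max n (i + 1), hn.trans ?_⟩
        have h1 : s i n ≤ ∑ j ∈ Finset.range (max n (i + 1)), s j (max n (i + 1)) :=
          (hmono i (le_max_left n (i + 1))).trans
            (Finset.single_le_sum (f := fun j => s j (max n (i + 1))) (fun j _ => hpos j _)
              (Finset.mem_range.2 (lt_of_lt_of_le i.lt_succ_self (le_max_right _ _))))
        exact h1 ω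
      · intro n
        rw [map_sum]
        refine (Finset.le_sum_of_subadditive ENNReal.ofReal ENNReal.ofReal_zero.le
          (fun _ _ => ENNReal.ofReal_add_le) _ _).trans ?_
        exact (Finset.sum_le_sum fun i _ => hμ i n).trans (ENNReal.sum_le_tsum _)
    calc sInf {r | IsDaniellCover μ (⋃ i, A i) r} ≤ ∑' i, r i := sInf_le hcov
      _ ≤ ∑' i, (sInf {r | IsDaniellCover μ (A i) r} + δ i) :=
            ENNReal.tsum_le_tsum fun i => (hlt i).le
      _ ≤ _ := by rw [ENNReal.tsum_add]; gcongr

theorem daniellOuterMeasure_le {M : Submodule ℝ (Ω → ℝ)} {μ : M →ₗ[ℝ] ℝ} {A : Set Ω} {r : ENNReal}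
    (h : IsDaniellCover μ A r) : daniellOuterMeasure μ A ≤ r := sInf_le h

/-- A cover $s$ of $A$ is split with ramps $h_k\uparrow 1_{\{X>a\}}$ in `M`. Since $h_k$ vanishes
off $\{X>a\}$, the remainder $s-s\wedge h_k$ covers $A\setminus\{X>a\}$, while the diagonal
$s_k\wedge h_k$ covers $A\cap\{X>a\}$. -/
theorem measurable_daniellOuterMeasure_caratheodory {M : Submodule ℝ (Ω → ℝ)}
    (hone : (1 : Ω → ℝ) ∈ M) (hR : IsRieszSubspace M) {μ : M →ₗ[ℝ] ℝ} (hμ : ∀ X, 0 ≤ X → 0 ≤ μ X)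
    {X : Ω → ℝ} (hX : X ∈ M) (a : ℝ) :
    (daniellOuterMeasure μ).IsCaratheodory (X ⁻¹' Set.Ioi a) := by
  rw [OuterMeasure.isCaratheodory_iff_le']
  intro A
  refine le_sInf fun r hr => ?_
  obtain ⟨s, hmono, hpos, hs, hle⟩ := hr
  have hμmono : ∀ X Y, X ≤ Y → μ X ≤ μ Y := fun X Y h => by
    have := hμ (Y - X) (sub_nonneg.2 h)
    rwa [map_sub, sub_nonneg] at this
  set h : ℕ → Ω → ℝ := fun k ω => min 1 (k * max (X ω - a) 0) with hh
  have hhM : ∀ k, h k ∈ M := fun k =>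
    hR _ hone _ (M.smul_mem (k : ℝ) (hR.sup_mem (M.sub_mem hX (const_mem hone a)) M.zero_mem))
  have hh0 : ∀ k ω, 0 ≤ h k ω := fun k ω =>
    le_min zero_le_one (mul_nonneg k.cast_nonneg (le_max_right _ _))
  have hhmono : ∀ ω, Monotone fun k => h k ω := fun ω k l hkl =>
    min_le_min_left _ (mul_le_mul_of_nonneg_right (Nat.cast_le.2 hkl) (le_max_right _ _))
  set p : ℕ → ℕ → M := fun k n => ⟨(s n : Ω → ℝ) ⊓ h k, hR _ (s n).2 _ (hhM k)⟩ with hp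
  have hp0 : ∀ k n, 0 ≤ p k n := fun k n ω => le_min (hpos n ω) (hh0 k ω)
  have hpmono : ∀ k, Monotone (p k) := fun k m n hmn ω => min_le_min_right _ (hmono hmn ω)
  set q : ℕ → ℕ → M := fun k n => s n - p k n with hq
  have hq0 : ∀ k n, 0 ≤ q k n := fun k n ω =>
    sub_nonneg.2 (min_le_left ((s n : Ω → ℝ) ω) (h k ω))
  have hqmono : ∀ k, Monotone (q k) := by
    intro k m n hmn ω
    have := hmono hmn ω
    change (s m : Ω → ℝ) ω - min ((s m : Ω → ℝ) ω) (h k ω) ≤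
      (s n : Ω → ℝ) ω - min ((s n : Ω → ℝ) ω) (h k ω)
    have this : (s m : Ω → ℝ) ω ≤ (s n : Ω → ℝ) ω := this
    rcases min_cases ((s m : Ω → ℝ) ω) (h k ω) with h1 | h1 <;>
    rcases min_cases ((s n : Ω → ℝ) ω) (h k ω) with h2 | h2 <;> linarith
  have key : ∀ k, (⨆ n, ENNReal.ofReal (μ (p k n))) + daniellOuterMeasure μ (A \ X ⁻¹' Set.Ioi a)
      ≤ r := by
    intro k
    have h1 : daniellOuterMeasure μ (A \ X ⁻¹' Set.Ioi a) ≤ ⨆ n, ENNReal.ofReal (μ (q k n)) := by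
      refine daniellOuterMeasure_le ⟨q k, hqmono k, hq0 k, fun ω hω b hb => ?_,
        fun n => le_iSup (fun n => ENNReal.ofReal (μ (q k n))) n⟩
      obtain ⟨n, hn⟩ := hs ω hω.1 b hb
      refine ⟨n, ?_⟩
      have h0 : h k ω = 0 := by
        have : X ω - a ≤ 0 := by simpa using hω.2
        simp [hh, max_eq_right this]
      change b ≤ (s n : Ω → ℝ) ω - min ((s n : Ω → ℝ) ω) (h k ω)
      have h1 : 0 ≤ (s n : Ω → ℝ) ω := hpos n ω
      rw [h0, min_eq_right h1]
      simpa using hn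
    refine (add_le_add le_rfl h1).trans ?_
    rw [ENNReal.iSup_add_iSup_of_monotone
      (fun m n hmn => ENNReal.ofReal_le_ofReal (hμmono _ _ (hpmono k hmn)))
      (fun m n hmn => ENNReal.ofReal_le_ofReal (hμmono _ _ (hqmono k hmn)))]
    refine iSup_le fun n => ?_
    rw [← ENNReal.ofReal_add (hμ _ (hp0 k n)) (hμ _ (hq0 k n)), ← map_add]
    simpa [hq] using hle n
  have h2 : daniellOuterMeasure μ (A ∩ X ⁻¹' Set.Ioi a) ≤
      ⨆ k, ⨆ n, ENNReal.ofReal (μ (p k n)) := by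
    refine daniellOuterMeasure_le ⟨fun k => p k k, fun m n hmn ω => ?_, fun k => hp0 k k,
      fun ω hω b hb => ?_, fun n => ?_⟩
    · exact min_le_min (hmono hmn ω) (hhmono ω hmn)
    · obtain ⟨n, hn⟩ := hs ω hω.1 b hb
      have hXa : 0 < X ω - a := sub_pos.2 hω.2
      obtain ⟨k, hk⟩ := exists_nat_ge (1 / (X ω - a))
      rw [div_le_iff₀ hXa] at hk
      refine ⟨max n k, le_min (hn.trans (hmono (le_max_left n k) ω)) ?_⟩
      refine le_trans ?_ (hhmono ω (le_max_right n k))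
      simp only [hh, max_eq_left hXa.le]
      exact le_min hb.le (hb.le.trans hk)
    · exact (le_iSup (fun m => ENNReal.ofReal (μ (p n m))) n).trans
        (le_iSup (fun k => ⨆ m, ENNReal.ofReal (μ (p k m))) n)
  refine (add_le_add h2 le_rfl).trans ?_
  rw [ENNReal.iSup_add]
  exact iSup_le key

/-- Only $\int f\,d\nu\le\mu f$ for $f\ge0$ needs work: adding a constant removes the sign
condition, and passing to $-f$ gives equality. -/
theorem exists_probabilityMeasure_forall_integral_eq [mΩ : MeasurableSpace Ω]
    {M : Submodule ℝ (Ω → ℝ)} (hM : M ≤ LInfty Ω)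
    (hone : (1 : Ω → ℝ) ∈ M) (hR : IsRieszSubspace M) (hσ : mΩ = sigmaGenerated M)
    {μ : M →ₗ[ℝ] ℝ} (hμ : ∀ X, 0 ≤ X → 0 ≤ μ X) (hμ1 : μ ⟨1, hone⟩ = 1)
    (hcont : ∀ Xs : ℕ → M, Antitone Xs → (∀ ω, Tendsto (fun n => (Xs n : Ω → ℝ) ω) atTop (𝓝 0)) →
      Tendsto (fun n => μ (Xs n)) atTop (𝓝 0)) :
    ∃ ν : ProbabilityMeasure Ω, integralFunctional ν ∘ₗ Submodule.inclusion hM = μ := by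
  have hμmono : ∀ X Y, X ≤ Y → μ X ≤ μ Y := fun X Y h => by
    have := hμ (Y - X) (sub_nonneg.2 h)
    rwa [map_sub, sub_nonneg] at this
  have hcar : mΩ ≤ (daniellOuterMeasure μ).caratheodory := by
    refine hσ.le.trans (iSup₂_le fun X hX => ?_)
    have : @Measurable Ω ℝ (daniellOuterMeasure μ).caratheodory _ X :=
      measurable_of_Ioi fun a =>
        measurable_daniellOuterMeasure_caratheodory hone hR hμ hX a
    have h2 := this.comap_le
    rwa [BorelSpace.measurable_eq (α := ℝ)] at h2
  set ν : Measure Ω := (daniellOuterMeasure μ).toMeasure hcar with hν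
  have hνle : ∀ {A : Set Ω}, MeasurableSet A → ∀ g : M, 0 ≤ g → (∀ ω ∈ A, 1 ≤ (g : Ω → ℝ) ω) →
      ν A ≤ ENNReal.ofReal (μ g) := by
    intro A hA g hg h1
    rw [hν, toMeasure_apply _ _ hA]
    exact daniellOuterMeasure_le ⟨fun _ => g, monotone_const, fun _ => hg,
      fun ω hω a ha => ⟨0, ha.le.trans (h1 ω hω)⟩, fun _ => le_rfl⟩
  have hprob : IsProbabilityMeasure ν := by
    refine ⟨le_antisymm ?_ ?_⟩
    · have := hνle MeasurableSet.univ ⟨1, hone⟩ (fun _ => zero_le_one) (fun _ _ => le_rfl)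
      simpa [hμ1] using this
    · rw [hν, toMeasure_apply _ _ MeasurableSet.univ]
      refine le_sInf fun r hr => ?_
      obtain ⟨s, hmono, hpos, hs, hle⟩ := hr
      -- $(1-s_n)^+$ decreases to $0$ for any cover $s$ of the whole space, so `hcont` forces mass
      -- at least $1$.
      set e : ℕ → M := fun n => ⟨(1 - (s n : Ω → ℝ)) ⊔ 0,
        hR.sup_mem (M.sub_mem hone (s n).2) M.zero_mem⟩ with he
      have he0 : Tendsto (fun n => μ (e n)) atTop (𝓝 0) := by
        refine hcont e (fun m n hmn ω => ?_) fun ω => ?_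
        · exact max_le_max_right _ (sub_le_sub_left (hmono hmn ω) _)
        · refine tendsto_order.2 ⟨fun b hb => Eventually.of_forall fun n =>
            hb.trans_le (le_max_right _ _), fun b hb => ?_⟩
          obtain ⟨n, hn⟩ := hs ω (Set.mem_univ _) (1 - b / 2) (by linarith)
          refine eventually_atTop.2 ⟨n, fun m hm => max_lt ?_ hb⟩
          have h1 : (s n : Ω → ℝ) ω ≤ (s m : Ω → ℝ) ω := hmono hm ω
          change 1 - (s m : Ω → ℝ) ω < b
          linarith
      have h1 : ∀ n, 1 - μ (e n) ≤ μ (s n) := by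
        intro n
        have : (⟨1, hone⟩ : M) - s n ≤ e n := fun ω => le_max_left _ _
        have := hμmono _ _ this
        rw [map_sub, hμ1] at this
        linarith
      have h2 : Tendsto (fun n => ENNReal.ofReal (1 - μ (e n))) atTop (𝓝 1) := by
        have := ENNReal.tendsto_ofReal (he0.const_sub 1)
        simpa using this
      exact le_of_tendsto' h2 fun n => (ENNReal.ofReal_le_ofReal (h1 n)).trans (hle n)
  set P : ProbabilityMeasure Ω := ⟨ν, hprob⟩ with hP
  set I : M →ₗ[ℝ] ℝ := integralFunctional P ∘ₗ Submodule.inclusion hM with hI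
  have hIapp : ∀ X : M, I X = ∫ ω, (X : Ω → ℝ) ω ∂ν := fun _ => rfl
  have hint : ∀ X : M, Integrable (X : Ω → ℝ) ν := fun X =>
    integrable_of_mem_LInfty P (Submodule.inclusion hM X)
  have hle : ∀ f : M, 0 ≤ f → I f ≤ μ f := by
    intro f hf
    refine le_of_forall_pos_le_add fun δ hδ => ?_
    set φ : ℕ → M := fun j => ⟨(f : Ω → ℝ) ⊓ fun _ => j * δ, hR _ f.2 _ (const_mem hone _)⟩ with hφ
    have hφapp : ∀ j ω, (φ j : Ω → ℝ) ω = min ((f : Ω → ℝ) ω) (j * δ) := fun _ _ => rfl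
    have hφmono : ∀ j, φ j ≤ φ (j + 1) := fun j ω => by
      refine min_le_min_left _ ?_
      push_cast
      linarith
    -- Each slice of height $\delta$ is integrated against the indicator of $\{f>(j+1)\delta\}$,
    -- which the preceding slice divided by $\delta$ dominates. The index shift costs one slice, at
    -- most $\delta$ in total.
    have hstep : ∀ j, I (φ (j + 2)) - I (φ (j + 1)) ≤ μ (φ (j + 1)) - μ (φ j) := by
      intro j
      set A : Set Ω := (f : Ω → ℝ) ⁻¹' Set.Ioi ((j + 1) * δ) with hA
      have hAm : MeasurableSet A := (hM f.2).1 measurableSet_Ioi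
      have h1 : I (φ (j + 2)) - I (φ (j + 1)) ≤ δ * ν.real A := by
        rw [hIapp, hIapp, ← integral_sub (hint _) (hint _), mul_comm, ← smul_eq_mul,
          ← integral_indicator_const _ hAm]
        refine integral_mono ((hint _).sub (hint _)) ((integrable_const _).indicator hAm) fun ω => ?_
        simp only [hφapp]
        push_cast
        by_cases hω : ω ∈ A
        · rw [Set.indicator_of_mem hω]
          have hω : (j + 1) * δ < (f : Ω → ℝ) ω := hω
          rw [min_eq_right hω.le]
          have := min_le_right ((f : Ω → ℝ) ω) ((j + 2) * δ)
          linarith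
        · rw [Set.indicator_of_notMem hω]
          have hω : (f : Ω → ℝ) ω ≤ (j + 1) * δ := not_lt.1 hω
          rw [min_eq_left hω, min_eq_left (by linarith)]
          simp
      have h2 : ν.real A ≤ μ (δ⁻¹ • (φ (j + 1) - φ j)) := by
        have hg0 : 0 ≤ δ⁻¹ • (φ (j + 1) - φ j) := fun ω =>
          mul_nonneg (inv_nonneg.2 hδ.le) (sub_nonneg.2 (hφmono j ω))
        refine ENNReal.toReal_le_of_le_ofReal (hμ _ hg0) (hνle hAm _ hg0 fun ω hω => ?_)
        have hω : (j + 1) * δ < (f : Ω → ℝ) ω := hω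
        change 1 ≤ δ⁻¹ * ((φ (j + 1) : Ω → ℝ) ω - (φ j : Ω → ℝ) ω)
        rw [hφapp, hφapp, min_eq_right (by push_cast; exact hω.le), min_eq_right (by linarith)]
        push_cast
        rw [show ((j + 1) * δ - j * δ : ℝ) = δ by ring, inv_mul_cancel₀ hδ.ne']
      rw [map_smul, map_sub, smul_eq_mul] at h2
      have h3 := mul_le_mul_of_nonneg_left h2 hδ.le
      rw [← mul_assoc, mul_inv_cancel₀ hδ.ne', one_mul] at h3
      exact h1.trans h3
    have hind : ∀ j, I (φ (j + 1)) ≤ μ (φ j) + δ := by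
      intro j
      induction j with
      | zero =>
        have h0 : 0 ≤ μ (φ 0) := hμ _ fun ω => le_min (hf ω) (by simp)
        have h1 : I (φ 1) ≤ δ := by
          rw [hIapp]
          calc ∫ ω, (φ 1 : Ω → ℝ) ω ∂ν ≤ ∫ _, δ ∂ν :=
                integral_mono (hint _) (integrable_const _) fun ω => by
                  simp only [hφapp]
                  exact (min_le_right _ _).trans (by simp)
            _ = δ := by simp
        linarith
      | succ j ih => linarith [hstep j]
    obtain ⟨C, hC⟩ := (hM f.2).2
    obtain ⟨N, hN⟩ := exists_nat_ge (C / δ)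
    rw [div_le_iff₀ hδ] at hN
    have hfN : φ (N + 1) = f := by
      refine Subtype.ext (funext fun ω => ?_)
      rw [hφapp, min_eq_left]
      have := (abs_le.1 (hC ω)).2
      push_cast
      linarith
    have := hind N
    rw [hfN] at this
    exact this.trans (add_le_add_left (hμmono _ _ fun ω => min_le_left _ _) _)
  have hone' : I ⟨1, hone⟩ = 1 := by
    rw [hIapp]
    simp
  have hle' : ∀ f : M, I f ≤ μ f := by
    intro f
    obtain ⟨C, hC⟩ := (hM f.2).2
    have := hle (f + C • ⟨1, hone⟩) fun ω => by
      change 0 ≤ (f : Ω → ℝ) ω + C * 1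
      linarith [(abs_le.1 (hC ω)).1]
    rw [map_add, map_add, map_smul, map_smul, hone', hμ1] at this
    linarith
  refine ⟨P, LinearMap.ext fun f => le_antisymm (hle' f) ?_⟩
  have := hle' (-f)
  rw [map_neg, map_neg] at this
  linarith

/-! ### Subgradients by Hahn–Banach -/

/-- A finite convex function on a real vector space has a subgradient at the origin. -/
theorem exists_linearMap_le_sub_of_convexOn {V : Type*} [AddCommGroup V] [Module ℝ V] {G : V → ℝ}
    (hG : ConvexOn ℝ Set.univ G) : ∃ μ : V →ₗ[ℝ] ℝ, ∀ x, μ x ≤ G x - G 0 := by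
  set q : V → Set.Ioi (0 : ℝ) → ℝ := fun x t => (G ((t : ℝ) • x) - G 0) / t with hq
  have hlow : ∀ x (t : Set.Ioi (0 : ℝ)), -(G (-x) - G 0) ≤ q x t := by
    rintro x ⟨t, ht⟩
    have ht : 0 < t := ht
    have h := hG.2 (Set.mem_univ (t • x)) (Set.mem_univ (-x))
      (by positivity : 0 ≤ 1 / (1 + t)) (by positivity : 0 ≤ t / (1 + t)) (by field_simp)
    -- The origin is a convex combination of $tx$ and $-x$, which bounds the difference quotients
    -- from below.
    have h0 : (1 / (1 + t)) • t • x + (t / (1 + t)) • (-x) = 0 := by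
      rw [smul_smul, smul_neg, ← sub_eq_add_neg, ← sub_smul]
      convert zero_smul ℝ x using 2
      ring
    rw [h0] at h
    simp only [hq, smul_eq_mul] at h ⊢
    rw [le_div_iff₀ ht]
    have : (1 + t) * G 0 ≤ G (t • x) + t * G (-x) := by
      have := mul_le_mul_of_nonneg_left h (by positivity : 0 ≤ 1 + t)
      calc _ ≤ _ := this
        _ = _ := by field_simp
    linarith
  have hbdd : ∀ x, BddBelow (Set.range (q x)) := fun x =>
    ⟨-(G (-x) - G 0), by rintro _ ⟨t, rfl⟩; exact hlow x t⟩
  have : Nonempty (Set.Ioi (0 : ℝ)) := ⟨⟨1, by simp⟩⟩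
  obtain ⟨μ, -, hμ⟩ := exists_extension_of_le_sublinear (⊥ : V →ₗ.[ℝ] ℝ) (fun x => ⨅ t, q x t)
    (by
      have key : ∀ c : ℝ, 0 < c → ∀ x, c * (⨅ t, q x t) ≤ ⨅ t, q (c • x) t := by
        intro c hc x
        refine le_ciInf fun t => ?_
        have ht : 0 < (t : ℝ) := t.2
        have h := ciInf_le (hbdd x) ⟨t * c, mul_pos ht hc⟩
        have h2 := mul_le_mul_of_nonneg_left h hc.le
        refine h2.trans (le_of_eq ?_)
        simp only [hq, smul_smul]
        field_simp
      intro c hc x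
      refine le_antisymm ?_ (key c hc x)
      have := key c⁻¹ (inv_pos.2 hc) (c • x)
      rw [smul_smul, inv_mul_cancel₀ hc.ne', one_smul] at this
      rwa [inv_mul_le_iff₀ hc] at this)
    (by
      intro x y
      refine le_ciInf_add_ciInf fun t s => ?_
      have ht : 0 < (t : ℝ) := t.2
      have hs : 0 < (s : ℝ) := s.2
      -- With this parameter, $\frac{ts}{t+s}(x+y)$ is a convex combination of $tx$ and $sy$.
      refine (ciInf_le (hbdd _) ⟨t * s / (t + s : ℝ), by simp only [Set.mem_Ioi]; positivity⟩).trans ?_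
      have h := hG.2 (Set.mem_univ ((t : ℝ) • x)) (Set.mem_univ ((s : ℝ) • y))
        (by positivity : 0 ≤ (s : ℝ) / (t + s)) (by positivity : 0 ≤ (t : ℝ) / (t + s))
        (by field_simp; ring)
      have h0 : ((s : ℝ) / (t + s)) • (t : ℝ) • x + ((t : ℝ) / (t + s)) • (s : ℝ) • y
          = ((t : ℝ) * s / (t + s)) • (x + y) := by
        rw [smul_smul, smul_smul, smul_add]
        congr 2 <;> ring
      rw [h0] at h
      simp only [hq, smul_eq_mul] at h ⊢
      rw [div_le_iff₀ (by positivity)]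
      have e : ((G ((t : ℝ) • x) - G 0) / t + (G ((s : ℝ) • y) - G 0) / s) * (t * s / (t + s) : ℝ)
          = ((s / (t + s) : ℝ) * G ((t : ℝ) • x) + (t / (t + s) : ℝ) * G ((s : ℝ) • y)) - G 0 := by
        field_simp
        ring
      rw [e]
      linarith)
    (by
      rintro ⟨x, hx⟩
      obtain rfl : x = 0 := (Submodule.mem_bot ℝ).1 hx
      refine le_ciInf fun t => ?_
      have : (⊥ : V →ₗ.[ℝ] ℝ) ⟨0, hx⟩ = 0 := (⊥ : V →ₗ.[ℝ] ℝ).map_zero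
      simp [hq, this])
  refine ⟨μ, fun x => (hμ x).trans ((ciInf_le (hbdd x) ⟨1, by simp⟩).trans ?_)⟩
  simp [hq]

/-! ### The extension `Ē` -/

theorem iInf_coe_le_coe_iff (x : ℕ → ℝ) (b : ℝ) :
    (⨅ n, (x n : EReal)) ≤ (b : EReal) ↔ ∀ a : ℝ, (∀ n, a ≤ x n) → a ≤ b := by
  refine ⟨fun h a ha => EReal.coe_le_coe_iff.1 ((le_iInf fun n => ?_).trans h), fun h => ?_⟩
  · exact EReal.coe_le_coe_iff.2 (ha n)
  · refine EReal.ge_of_forall_gt_iff_ge.1 fun z hz => EReal.coe_le_coe_iff.2 (h z fun n => ?_)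
    exact EReal.coe_le_coe_iff.1 (hz.le.trans (iInf_le _ n))

theorem coe_le_barExtension {M : Submodule ℝ (Ω → ℝ)} {E : M → ℝ} {X : Ω → ℝ} {Ys : ℕ → M}
    (hY : Antitone Ys) (hYX : ∀ ω a, (∀ n, a ≤ (Ys n : Ω → ℝ) ω) → a ≤ X ω) {c : ℝ}
    (hc : ∀ n, c ≤ E (Ys n)) : (c : EReal) ≤ barExtension E X :=
  le_sSup_of_le ⟨Ys, hY, fun ω => (iInf_coe_le_coe_iff _ _).2 (hYX ω), rfl⟩
    (le_iInf fun n => EReal.coe_le_coe_iff.2 (hc n))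

theorem barExtension_le_iff {M : Submodule ℝ (Ω → ℝ)} {E : M → ℝ} {X : Ω → ℝ} {b : EReal} :
    barExtension E X ≤ b ↔ ∀ Ys : ℕ → M, Antitone Ys →
      (∀ ω a, (∀ n, a ≤ (Ys n : Ω → ℝ) ω) → a ≤ X ω) → ∀ c : ℝ, (∀ n, c ≤ E (Ys n)) →
      (c : EReal) ≤ b := by
  refine ⟨fun h Ys h1 h2 c hc => (coe_le_barExtension h1 h2 hc).trans h, fun h => sSup_le ?_⟩
  rintro _ ⟨Ys, hY, hYX, rfl⟩
  refine EReal.ge_of_forall_gt_iff_ge.1 fun z hz =>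
    h Ys hY (fun ω => (iInf_coe_le_coe_iff _ _).1 (hYX ω)) z fun n => ?_
  exact EReal.coe_le_coe_iff.1 (hz.le.trans (iInf_le _ n))

theorem barExtension_mono {M : Submodule ℝ (Ω → ℝ)} {E : M → ℝ} {X Y : Ω → ℝ} (h : X ≤ Y) :
    barExtension E X ≤ barExtension E Y :=
  barExtension_le_iff.2 fun _ h1 h2 _ hc =>
    coe_le_barExtension h1 (fun ω a ha => (h2 ω a ha).trans (h ω)) hc

/-- For monotone `E` and bounded `X`, sequences that are bounded below suffice in the definition of
`barExtension`. -/
theorem barExtension_le_of_forall_bounded {M : Submodule ℝ (Ω → ℝ)} (hone : (1 : Ω → ℝ) ∈ M)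
    (hR : IsRieszSubspace M) {E : M → ℝ} (hE : ∀ X Y, X ≤ Y → E X ≤ E Y) {X : Ω → ℝ} {C : ℝ}
    (hC : ∀ ω, -C ≤ X ω) {b : EReal}
    (h : ∀ Ys : ℕ → M, Antitone Ys → (∀ n ω, -C ≤ (Ys n : Ω → ℝ) ω) →
      (∀ ω a, (∀ n, a ≤ (Ys n : Ω → ℝ) ω) → a ≤ X ω) → ∀ c : ℝ, (∀ n, c ≤ E (Ys n)) →
      (c : EReal) ≤ b) :
    barExtension E X ≤ b := by
  refine barExtension_le_iff.2 fun Ys hY hYX c hc => ?_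
  refine h (fun n => ⟨(Ys n : Ω → ℝ) ⊔ fun _ => -C, hR.sup_mem (Ys n).2 (const_mem hone _)⟩)
    (fun m n hmn ω => max_le_max_right _ (hY hmn ω)) (fun n ω => le_max_right _ _) (fun ω a ha => ?_) c
    fun n => (hc n).trans (hE _ _ fun ω => le_max_left _ _)
  by_cases haC : a ≤ -C
  · exact haC.trans (hC ω)
  · exact hYX ω a fun n => (le_max_iff.1 (ha n)).resolve_right haC

/-- The bound $-C$ makes $\inf_n Y_n$ a bounded function, hence a member of $M_\delta$ at which `F`
is the limit of its values on the sequence. -/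
theorem le_of_forall_le_of_continuousFromAboveOn [MeasurableSpace Ω] {M : Submodule ℝ (Ω → ℝ)}
    (hM : M ≤ LInfty Ω) {F : LInfty Ω → ℝ} (hmono : ∀ X Y, X ≤ Y → F X ≤ F Y)
    (hF : ContinuousFromAboveOn F (deltaSet M)) {X : LInfty Ω} {Ys : ℕ → M} (hY : Antitone Ys)
    {C : ℝ} (hC : ∀ n ω, -C ≤ (Ys n : Ω → ℝ) ω)
    (hYX : ∀ ω a, (∀ n, a ≤ (Ys n : Ω → ℝ) ω) → a ≤ (X : Ω → ℝ) ω) {c : ℝ}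
    (hc : ∀ n, c ≤ F (Submodule.inclusion hM (Ys n))) : c ≤ F X := by
  set Y : Ω → ℝ := fun ω => ⨅ n, (Ys n : Ω → ℝ) ω with hYdef
  have hbdd : ∀ ω, BddBelow (Set.range fun n => (Ys n : Ω → ℝ) ω) := fun ω =>
    ⟨-C, by rintro _ ⟨n, rfl⟩; exact hC n ω⟩
  have hlim : ∀ ω, Tendsto (fun n => (Ys n : Ω → ℝ) ω) atTop (𝓝 (Y ω)) := fun ω =>
    tendsto_atTop_ciInf (fun m n hmn => hY hmn ω) (hbdd ω)
  have hYb : IsBoundedFun Y := by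
    obtain ⟨D, hD⟩ := (hM (Ys 0).2).2
    refine ⟨max C D, fun ω => abs_le.2 ⟨?_, ?_⟩⟩
    · have : -C ≤ Y ω := le_ciInf fun n => hC n ω
      linarith [le_max_left C D]
    · exact (ciInf_le (hbdd ω) 0).trans ((abs_le.1 (hD ω)).2.trans (le_max_right _ _))
  have hYδ : Y ∈ deltaSet M := ⟨hYb, Ys, hY, hlim⟩
  have hnδ : ∀ n, (Ys n : Ω → ℝ) ∈ deltaSet M := fun n =>
    ⟨(hM (Ys n).2).2, fun _ => Ys n, antitone_const, fun _ => tendsto_const_nhds⟩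
  have := (hF (fun n => Submodule.inclusion hM (Ys n)) ⟨Y, deltaSet_subset hM hYδ⟩ hnδ hYδ
    (fun m n hmn => hY hmn) hlim).2
  refine (ge_of_tendsto' this hc).trans (hmono _ _ fun ω => hYX ω _ fun n => ?_)
  exact ciInf_le (hbdd ω) n

/-- Choquet's theorem: a regular functional is the bar extension of its restriction to `M`. -/
theorem barExtension_comp_inclusion [mΩ : MeasurableSpace Ω] {M : Submodule ℝ (Ω → ℝ)}
    (hM : M ≤ LInfty Ω) (hone : (1 : Ω → ℝ) ∈ M) (hR : IsRieszSubspace M)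
    (hσ : mΩ = sigmaGenerated M) {F : LInfty Ω → ℝ} (hmono : ∀ X Y, X ≤ Y → F X ≤ F Y)
    (hb : ContinuousFromBelow F) (ha : ContinuousFromAboveOn F (deltaSet M)) (X : LInfty Ω) :
    barExtension (fun Y : M => F (Submodule.inclusion hM Y)) (X : Ω → ℝ) = F X := by
  obtain ⟨-, C, hC⟩ := id X.2
  refine le_antisymm ?_ ?_
  · refine barExtension_le_of_forall_bounded hone hR (fun Y Z h => hmono _ _ h)
      (fun ω => (abs_le.1 (hC ω)).1) fun Ys hY hYC hYX c hc => ?_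
    exact EReal.coe_le_coe_iff.2
      (le_of_forall_le_of_continuousFromAboveOn hM hmono ha hY hYC hYX hc)
  · refine EReal.ge_of_forall_gt_iff_ge.1 fun z hz => ?_
    obtain ⟨Ys, hY, hYX, hc⟩ :=
      exists_antitone_of_lt hM hone hR hσ hmono hb X (EReal.coe_lt_coe_iff.1 hz)
    exact coe_le_barExtension hY hYX hc

/-! ### Integral functionals -/

theorem integralFunctional_mono [MeasurableSpace Ω] (ν : ProbabilityMeasure Ω) (X Y : LInfty Ω)
    (h : X ≤ Y) : integralFunctional ν X ≤ integralFunctional ν Y :=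
  integral_mono (integrable_of_mem_LInfty ν X) (integrable_of_mem_LInfty ν Y) h

theorem continuousFromBelow_integralFunctional [MeasurableSpace Ω] (ν : ProbabilityMeasure Ω) :
    ContinuousFromBelow (integralFunctional ν) := fun Xs X hX hlim =>
  ⟨fun _ _ h => integralFunctional_mono ν _ _ (hX h),
    integral_tendsto_of_tendsto_of_monotone (fun n => integrable_of_mem_LInfty ν (Xs n))
      (integrable_of_mem_LInfty ν X) (Eventually.of_forall fun ω _ _ h => hX h ω)
      (Eventually.of_forall hlim)⟩

theorem continuousFromAboveOn_integralFunctional [MeasurableSpace Ω] (ν : ProbabilityMeasure Ω)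
    (S : Set (Ω → ℝ)) : ContinuousFromAboveOn (integralFunctional ν) S := fun Xs X _ _ hX hlim =>
  ⟨fun _ _ h => integralFunctional_mono ν _ _ (hX h),
    integral_tendsto_of_tendsto_of_antitone (fun n => integrable_of_mem_LInfty ν (Xs n))
      (integrable_of_mem_LInfty ν X) (Eventually.of_forall fun ω _ _ h => hX h ω)
      (Eventually.of_forall hlim)⟩

theorem integralFunctional_comp_inclusion_mem_supDual [MeasurableSpace Ω]
    {M : Submodule ℝ (Ω → ℝ)} (hM : M ≤ LInfty Ω) (ν : ProbabilityMeasure Ω) :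
    integralFunctional ν ∘ₗ Submodule.inclusion hM ∈ supDual M := by
  refine ⟨1, fun X => ?_⟩
  obtain ⟨C, hC⟩ := (hM X.2).2
  have h : ∀ ω, |(X : Ω → ℝ) ω| ≤ supNorm (X : Ω → ℝ) := fun ω =>
    le_ciSup (f := fun ω => |(X : Ω → ℝ) ω|) ⟨C, by rintro _ ⟨ω, rfl⟩; exact hC ω⟩ ω
  have := norm_integral_le_of_norm_le_const (μ := (ν : Measure Ω))
    (f := (X : Ω → ℝ)) (Eventually.of_forall h)
  rw [probReal_univ, mul_one] at this
  rwa [one_mul]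

/-! ### Convex duality -/

theorem conjugate_le_coe_iff {D : Submodule ℝ (Ω → ℝ)} {E : D → ℝ} {μ : D →ₗ[ℝ] ℝ} {B : ℝ} :
    conjugate E μ ≤ (B : EReal) ↔ ∀ Z, μ Z - E Z ≤ B := by
  simp only [conjugate, iSup_le_iff, EReal.coe_le_coe_iff]

theorem conjugate_eq_top_or {D : Submodule ℝ (Ω → ℝ)} (E : D → ℝ) (μ : D →ₗ[ℝ] ℝ) :
    conjugate E μ = ⊤ ∨ ∃ B : ℝ, conjugate E μ = B ∧ ∀ Z, μ Z - E Z ≤ B := by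
  by_cases h : conjugate E μ = ⊤
  · exact Or.inl h
  · have hb : conjugate E μ ≠ ⊥ := fun hb => by
      have := le_iSup (fun X : D => ((μ X - E X : ℝ) : EReal)) 0
      exact EReal.coe_ne_bot _ (le_bot_iff.1 (this.trans hb.le))
    have e := EReal.coe_toReal h hb
    exact Or.inr ⟨_, e.symm, conjugate_le_coe_iff.1 e.ge⟩

theorem coe_le_coe_sub_conjugate {D : Submodule ℝ (Ω → ℝ)} {E : D → ℝ} {μ : D →ₗ[ℝ] ℝ} {c x : ℝ}
    (h : ∀ Z, μ Z - E Z + c ≤ x) : (c : EReal) ≤ (x : EReal) - conjugate E μ := by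
  have h1 : conjugate E μ ≤ ((x - c : ℝ) : EReal) :=
    conjugate_le_coe_iff.2 fun Z => by linarith [h Z]
  calc (c : EReal) = ((x - (x - c) : ℝ) : EReal) := by congr 1; ring
    _ = (x : EReal) - ((x - c : ℝ) : EReal) := EReal.coe_sub _ _
    _ ≤ _ := EReal.sub_le_sub le_rfl h1

/-- Along a decreasing sequence bounded below, the infimum of a convex pre-expectation is
attained by one affine minorant. -/
theorem exists_linearMap_of_antitone [MeasurableSpace Ω] {M : Submodule ℝ (Ω → ℝ)}
    (hM : M ≤ LInfty Ω) (hone : (1 : Ω → ℝ) ∈ M) {E : M → ℝ} (hE : IsPreExpectation E)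
    (hconv : ConvexOn ℝ Set.univ E) {Ys : ℕ → M} (hY : Antitone Ys) {C : ℝ}
    (hC : ∀ n ω, -C ≤ (Ys n : Ω → ℝ) ω) {c : ℝ} (hc : ∀ n, c ≤ E (Ys n)) :
    ∃ μ : M →ₗ[ℝ] ℝ, ∀ m Z, μ Z - E Z ≤ μ (Ys m) - c := by
  set G : M → ℝ := fun X => ⨅ n, E (Ys n + X) with hG
  have hbdd : ∀ X : M, BddBelow (Set.range fun n => E (Ys n + X)) := by
    intro X
    obtain ⟨D, hD⟩ := (hM X.2).2
    refine ⟨-C - D, ?_⟩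
    rintro _ ⟨n, rfl⟩
    rw [← hE.const (-C - D) (const_mem hone _)]
    refine hE.mono _ _ fun ω => ?_
    change -C - D ≤ (Ys n : Ω → ℝ) ω + (X : Ω → ℝ) ω
    linarith [hC n ω, (abs_le.1 (hD ω)).1]
  have hlim : ∀ X : M, Tendsto (fun n => E (Ys n + X)) atTop (𝓝 (G X)) := fun X =>
    tendsto_atTop_ciInf (fun m n hmn => hE.mono _ _ (add_le_add_left (hY hmn) X)) (hbdd X)
  have hGconv : ConvexOn ℝ Set.univ G := by
    refine ⟨convex_univ, fun X _ Z _ a b ha hb hab => ?_⟩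
    refine le_of_tendsto_of_tendsto' (hlim _)
      (((hlim X).const_smul a).add ((hlim Z).const_smul b)) fun n => ?_
    have e : Ys n + (a • X + b • Z) = a • (Ys n + X) + b • (Ys n + Z) := by
      rw [smul_add, smul_add, add_add_add_comm, ← add_smul, hab, one_smul]
    rw [e]
    exact hconv.2 (Set.mem_univ _) (Set.mem_univ _) ha hb hab
  obtain ⟨μ, hμ⟩ := exists_linearMap_le_sub_of_convexOn hGconv
  refine ⟨μ, fun m Z => ?_⟩
  have h0 : c ≤ G 0 := le_ciInf fun n => by simpa using hc n
  -- The increment $Z-Y_m$ is chosen so that the $m$-th term of the infimum is $E(Z)$.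
  have h1 : G (Z - Ys m) ≤ E Z := by
    have := ciInf_le (hbdd (Z - Ys m)) m
    rwa [add_sub_cancel] at this
  have h2 := hμ (Z - Ys m)
  rw [map_sub] at h2
  linarith

/-- In $\mu(tX)\le B+E(tX)$ the constant $B$ becomes negligible for large $t$. This yields
positivity, normalization and continuity along sequences decreasing to $0$. -/
theorem exists_probabilityMeasure_of_conjugate_bounded [mΩ : MeasurableSpace Ω]
    {M : Submodule ℝ (Ω → ℝ)} (hM : M ≤ LInfty Ω) (hone : (1 : Ω → ℝ) ∈ M)
    (hR : IsRieszSubspace M) (hσ : mΩ = sigmaGenerated M) {E : M → ℝ} (hE : IsPreExpectation E)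
    (habove : ContinuousFromAbove E) {μ : M →ₗ[ℝ] ℝ} {B : ℝ} (hB : ∀ Z, μ Z - E Z ≤ B) :
    ∃ ν : ProbabilityMeasure Ω, integralFunctional ν ∘ₗ Submodule.inclusion hM = μ := by
  have hscale : ∀ x : ℝ, (∀ t : ℝ, 0 < t → t * x ≤ B) → x ≤ 0 := by
    intro x hx
    by_contra! h
    obtain ⟨t, ht⟩ := exists_gt (max 0 (B / x))
    have h1 := hx t ((le_max_left _ _).trans_lt ht)
    have h2 := (le_max_right _ _).trans_lt ht
    rw [div_lt_iff₀ h] at h2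
    linarith
  have hE0 : E 0 = 0 := hE.const 0 M.zero_mem
  have hconst : ∀ a : ℝ, E (a • ⟨1, hone⟩) = a := by
    intro a
    have e : a • (⟨1, hone⟩ : M) = ⟨fun _ => a, const_mem hone a⟩ := by ext; simp
    rw [e, hE.const]
  have hμpos : ∀ X, 0 ≤ X → 0 ≤ μ X := by
    intro X hX
    have := hscale (-μ X) fun t ht => by
      have h1 := hB (-(t • X))
      have h2 : E (-(t • X)) ≤ 0 := by
        rw [← hE0]
        refine hE.mono _ _ fun ω => ?_
        exact neg_nonpos.2 (mul_nonneg ht.le (hX ω))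
      rw [map_neg, map_smul, smul_eq_mul] at h1
      linarith
    linarith
  have hμ1 : μ ⟨1, hone⟩ = 1 := by
    have h1 := hscale (μ ⟨1, hone⟩ - 1) fun t _ => by
      have h := hB (t • ⟨1, hone⟩)
      rw [hconst, map_smul, smul_eq_mul] at h
      linarith
    have h2 := hscale (1 - μ ⟨1, hone⟩) fun t _ => by
      have h := hB ((-t) • ⟨1, hone⟩)
      rw [hconst, map_smul, smul_eq_mul] at h
      linarith
    linarith
  refine exists_probabilityMeasure_forall_integral_eq hM hone hR hσ hμpos hμ1 fun Xs hX hlim => ?_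
  have hX0 : ∀ n, 0 ≤ Xs n := fun n ω =>
    Antitone.le_of_tendsto (f := fun n => (Xs n : Ω → ℝ) ω) (fun _ _ h => hX h ω) (hlim ω) n
  refine tendsto_order.2 ⟨fun b hb => Eventually.of_forall fun n => hb.trans_le (hμpos _ (hX0 n)),
    fun b hb => ?_⟩
  -- Then $B<tb/2$, and $E(tX_n)$ is eventually below $tb/2$ too.
  obtain ⟨t, ht⟩ := exists_gt (max 0 (2 * B / b))
  have ht0 : 0 < t := (le_max_left _ _).trans_lt ht
  have htB : 2 * B < t * b := by
    have := (le_max_right _ _).trans_lt ht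
    rwa [div_lt_iff₀ hb] at this
  have hlimE : Tendsto (fun n => E (t • Xs n)) atTop (𝓝 (E 0)) := by
    refine (habove (fun n => t • Xs n) 0 (fun n => (t • Xs n).2) M.zero_mem
      (fun m n h ω => mul_le_mul_of_nonneg_left (hX h ω) ht0.le) fun ω => ?_).2
    simpa using (hlim ω).const_mul t
  rw [hE0] at hlimE
  filter_upwards [hlimE.eventually_lt_const (show 0 < t * b / 2 by positivity)] with n hn
  have h := hB (t • Xs n)
  rw [map_smul, smul_eq_mul] at h
  have : t * μ (Xs n) < t * b := by linarith
  exact lt_of_mul_lt_mul_left this ht0.le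

theorem barExtension_eq_iSup_probabilityMeasure [mΩ : MeasurableSpace Ω]
    {M : Submodule ℝ (Ω → ℝ)} (hM : M ≤ LInfty Ω) (hone : (1 : Ω → ℝ) ∈ M)
    (hR : IsRieszSubspace M) (hσ : mΩ = sigmaGenerated M) {E : M → ℝ} (hE : IsPreExpectation E)
    (hconv : ConvexOn ℝ Set.univ E) (habove : ContinuousFromAbove E) (X : LInfty Ω) :
    barExtension E (X : Ω → ℝ) = ⨆ ν : ProbabilityMeasure Ω,
      ((integralFunctional ν X : ℝ) : EReal)
        - conjugate E (integralFunctional ν ∘ₗ Submodule.inclusion hM) := by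
  obtain ⟨-, C, hC⟩ := id X.2
  refine le_antisymm ?_ (iSup_le fun ν => ?_)
  · refine barExtension_le_of_forall_bounded hone hR hE.mono
      (fun ω => (abs_le.1 (hC ω)).1) fun Ys hY hYC hYX c hc => ?_
    obtain ⟨μ, hμ⟩ := exists_linearMap_of_antitone hM hone hE hconv hY hYC hc
    obtain ⟨ν, rfl⟩ :=
      exists_probabilityMeasure_of_conjugate_bounded hM hone hR hσ hE habove (hμ 0)
    refine le_iSup_of_le ν (coe_le_coe_sub_conjugate fun Z => ?_)
    refine le_of_forall_le_of_continuousFromAboveOn hM (integralFunctional_mono ν)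
      (continuousFromAboveOn_integralFunctional ν _) hY hYC hYX fun m => ?_
    have := hμ m Z
    simp only [LinearMap.comp_apply] at this ⊢
    linarith
  · rcases conjugate_eq_top_or E (integralFunctional ν ∘ₗ Submodule.inclusion hM) with h | ⟨B, h, hB⟩
    · rw [h, EReal.sub_top]
      exact bot_le
    · rw [h, ← EReal.coe_sub]
      refine EReal.ge_of_forall_gt_iff_ge.1 fun z hz => ?_
      -- Choquet's theorem for $\nu$ at level $z+B$: then $E(Y_n)\ge\nu Y_n-B\ge z$.
      obtain ⟨Ys, hY, hYX, hc⟩ := exists_antitone_of_lt hM hone hR hσ (integralFunctional_mono ν)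
        (continuousFromBelow_integralFunctional ν) X
        (lt_sub_iff_add_lt.1 (EReal.coe_lt_coe_iff.1 hz))
      refine coe_le_barExtension hY hYX fun n => ?_
      have h1 := hB (Ys n)
      have h2 := hc n
      simp only [LinearMap.comp_apply] at h1
      linarith

/-- Functionals with finite conjugate are restrictions of probability measures, whose bar extension
is the integral; measures with infinite conjugate contribute $-\infty$. -/
theorem iSup_supDual_eq_iSup_probabilityMeasure [mΩ : MeasurableSpace Ω]
    {M : Submodule ℝ (Ω → ℝ)} (hM : M ≤ LInfty Ω) (hone : (1 : Ω → ℝ) ∈ M)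
    (hR : IsRieszSubspace M) (hσ : mΩ = sigmaGenerated M) {E : M → ℝ} (hE : IsPreExpectation E)
    (habove : ContinuousFromAbove E) (X : LInfty Ω) :
    (⨆ μ ∈ {μ ∈ supDual M | conjugate E μ < ⊤},
      barExtension (fun Y : M => μ Y) (X : Ω → ℝ) - conjugate E μ) =
    ⨆ ν : ProbabilityMeasure Ω, ((integralFunctional ν X : ℝ) : EReal)
        - conjugate E (integralFunctional ν ∘ₗ Submodule.inclusion hM) := by
  have hbar : ∀ ν : ProbabilityMeasure Ω,
      barExtension (fun Y : M => (integralFunctional ν ∘ₗ Submodule.inclusion hM) Y) (X : Ω → ℝ)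
        = ((integralFunctional ν X : ℝ) : EReal) := fun ν =>
    barExtension_comp_inclusion hM hone hR hσ (integralFunctional_mono ν)
      (continuousFromBelow_integralFunctional ν) (continuousFromAboveOn_integralFunctional ν _) X
  refine le_antisymm (iSup₂_le fun μ hμ => ?_) (iSup_le fun ν => ?_)
  · obtain ⟨B, -, hB⟩ := (conjugate_eq_top_or E μ).resolve_left hμ.2.ne
    obtain ⟨ν, rfl⟩ := exists_probabilityMeasure_of_conjugate_bounded hM hone hR hσ hE habove hB
    rw [hbar ν]
    exact le_iSup (fun ν : ProbabilityMeasure Ω => ((integralFunctional ν X : ℝ) : EReal)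
        - conjugate E (integralFunctional ν ∘ₗ Submodule.inclusion hM)) ν
  · by_cases h : conjugate E (integralFunctional ν ∘ₗ Submodule.inclusion hM) = ⊤
    · rw [h, EReal.sub_top]
      exact bot_le
    · refine le_iSup₂_of_le (integralFunctional ν ∘ₗ Submodule.inclusion hM)
        ⟨integralFunctional_comp_inclusion_mem_supDual hM ν, lt_top_iff_ne_top.2 h⟩ ?_
      rw [hbar ν]

/-- For a competing sequence $(Y_n)$, $Y_n\vee X$ decreases to $X$ inside `M`, so continuity from
above applies. -/
theorem barExtension_coe {M : Submodule ℝ (Ω → ℝ)}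
    (hR : IsRieszSubspace M) {E : M → ℝ} (hE : IsPreExpectation E)
    (habove : ContinuousFromAbove E) (X : M) : barExtension E (X : Ω → ℝ) = E X := by
  refine le_antisymm (barExtension_le_iff.2 fun Ys hY hYX c hc => ?_)
    (coe_le_barExtension (Ys := fun _ => X) antitone_const (fun ω a ha => ha 0) fun _ => le_rfl)
  set Zs : ℕ → M := fun n => ⟨(Ys n : Ω → ℝ) ⊔ X, hR.sup_mem (Ys n).2 X.2⟩ with hZ
  have hlim := (habove Zs X (fun n => (Zs n).2) X.2
    (fun m n hmn ω => max_le_max_right _ (hY hmn ω)) fun ω => by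
      refine tendsto_order.2 ⟨fun b hb => Eventually.of_forall fun n =>
        hb.trans_le (le_max_right _ _), fun b hb => ?_⟩
      obtain ⟨n, hn⟩ : ∃ n, (Ys n : Ω → ℝ) ω < b := by
        by_contra! h
        exact absurd (hYX ω b h) (not_le.2 hb)
      exact eventually_atTop.2 ⟨n, fun m hm => max_lt ((hY hm ω).trans_lt hn) hb⟩).2
  exact EReal.coe_le_coe_iff.2
    (ge_of_tendsto' hlim fun n => (hc n).trans (hE.mono _ _ fun ω => le_max_left _ _))

/-- With $Z_{k,n}\downarrow X_k$ as $n\to\infty$, the diagonal minima $W_n=\min_{k\le n}Z_{k,n}$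
work. -/
theorem exists_antitone_diagonal {M : Submodule ℝ (Ω → ℝ)} (hR : IsRieszSubspace M)
    {Xs : ℕ → Ω → ℝ} {X : Ω → ℝ} (hXs : ∀ n, Xs n ∈ deltaSet M) (hanti : Antitone Xs)
    (hlim : ∀ ω, Tendsto (fun n => Xs n ω) atTop (𝓝 (X ω))) :
    ∃ Ws : ℕ → M, Antitone Ws ∧ (∀ n, Xs n ≤ Ws n) ∧
      ∀ ω a, (∀ n, a ≤ (Ws n : Ω → ℝ) ω) → a ≤ X ω := by
  choose Zs hZ hZlim using fun n => (hXs n).2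
  have hZX : ∀ k n ω, Xs k ω ≤ (Zs k n : Ω → ℝ) ω := fun k n ω =>
    Antitone.le_of_tendsto (f := fun n => (Zs k n : Ω → ℝ) ω) (fun _ _ h => hZ k h ω) (hZlim k ω) n
  set W : ℕ → Ω → ℝ := fun n =>
    (Finset.range (n + 1)).inf' Finset.nonempty_range_add_one fun k => (Zs k n : Ω → ℝ) with hW
  have hWle : ∀ n k, k ≤ n → W n ≤ Zs k n := fun n k hk =>
    Finset.inf'_le (fun k => (Zs k n : Ω → ℝ)) (Finset.mem_range.2 (Nat.lt_succ_of_le hk))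
  refine ⟨fun n => ⟨W n, Finset.inf'_mem (M : Set (Ω → ℝ)) (fun x hx y hy => hR x hx y hy) _ _ _
    fun k _ => (Zs k n).2⟩, antitone_nat_of_succ_le fun n => ?_, fun n => ?_, fun ω a ha => ?_⟩
  · change W (n + 1) ≤ W n
    refine Finset.le_inf' _ _ fun k hk => ?_
    have hk := Nat.lt_succ_iff.1 (Finset.mem_range.1 hk)
    exact (hWle (n + 1) k (hk.trans n.le_succ)).trans (hZ k n.le_succ)
  · change Xs n ≤ W n
    refine Finset.le_inf' _ _ fun k hk => ?_
    exact (hanti (Nat.lt_succ_iff.1 (Finset.mem_range.1 hk))).trans (hZX k n)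
  · refine ge_of_tendsto' (hlim ω) fun k => ?_
    refine ge_of_tendsto (hZlim k ω) (eventually_atTop.2 ⟨k, fun n hn => ?_⟩)
    exact (ha n).trans (hWle n k hn ω)

end NonlinearExpectation

end

/-! ### Assembly of the main theorem -/

open NonlinearExpectation in
theorem mainTheorem1 {Ω : Type*} [mΩ : MeasurableSpace Ω]
    (M : Submodule ℝ (Ω → ℝ)) (hM : M ≤ NonlinearExpectation.LInfty Ω)
    (hone : (1 : Ω → ℝ) ∈ M)
    (hRiesz : NonlinearExpectation.IsRieszSubspace M)
    (hσ : mΩ = NonlinearExpectation.sigmaGenerated M)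
    (E : M → ℝ) (hE : NonlinearExpectation.IsPreExpectation E)
    (hconv : ConvexOn ℝ Set.univ E)
    (habove : NonlinearExpectation.ContinuousFromAbove E) :
    ∃ Ebar : NonlinearExpectation.LInfty Ω → ℝ,
      -- `Ebar` is given by the explicit formula
      (∀ X : NonlinearExpectation.LInfty Ω,
        (Ebar X : EReal) = NonlinearExpectation.barExtension E (X : Ω → ℝ)) ∧
      -- it is an expectation extending `E`, with the two continuity properties
      NonlinearExpectation.IsPreExpectation Ebar ∧
      NonlinearExpectation.ContinuousFromBelow Ebar ∧
      NonlinearExpectation.ContinuousFromAboveOn Ebar (NonlinearExpectation.deltaSet M) ∧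
      (∀ X : M, Ebar (Submodule.inclusion hM X) = E X) ∧
      -- it is the only one
      (∀ F : NonlinearExpectation.LInfty Ω → ℝ,
        NonlinearExpectation.IsPreExpectation F →
        NonlinearExpectation.ContinuousFromBelow F →
        NonlinearExpectation.ContinuousFromAboveOn F (NonlinearExpectation.deltaSet M) →
        (∀ X : M, F (Submodule.inclusion hM X) = E X) →
        F = Ebar) ∧
      -- it is convex, with two dual representations
      ConvexOn ℝ Set.univ Ebar ∧
      (∀ X : NonlinearExpectation.LInfty Ω,
        (Ebar X : EReal) =
          ⨆ μ ∈ {μ ∈ NonlinearExpectation.supDual M |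
              NonlinearExpectation.conjugate E μ < ⊤},
            NonlinearExpectation.barExtension (fun Y : M => μ Y) (X : Ω → ℝ)
              - NonlinearExpectation.conjugate E μ) ∧
      (∀ X : NonlinearExpectation.LInfty Ω,
        (Ebar X : EReal) =
          ⨆ ν : ProbabilityMeasure Ω,
            ((NonlinearExpectation.integralFunctional ν X : ℝ) : EReal)
              - NonlinearExpectation.conjugate E
                  (NonlinearExpectation.integralFunctional ν ∘ₗ Submodule.inclusion hM)) ∧
      NonlinearExpectation.IsConvexExpectationSpace Ebar := by
  have hrep := barExtension_eq_iSup_probabilityMeasure hM hone hRiesz hσ hE hconv habove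
  have hext := barExtension_coe hRiesz hE habove
  set Ebar : LInfty Ω → ℝ := fun X => (barExtension E (X : Ω → ℝ)).toReal with hEbar
  have hcoe : ∀ X : LInfty Ω, (Ebar X : EReal) = barExtension E (X : Ω → ℝ) := by
    intro X
    obtain ⟨-, C, hC⟩ := id X.2
    have h1 : barExtension E (X : Ω → ℝ) ≤ _ :=
      (barExtension_mono fun ω => (abs_le.1 (hC ω)).2).trans
        (hext ⟨fun _ => C, const_mem hone C⟩).le
    have h2 := (hext ⟨fun _ => -C, const_mem hone (-C)⟩).ge.trans
      (barExtension_mono (Y := (X : Ω → ℝ)) fun ω => (abs_le.1 (hC ω)).1)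
    exact EReal.coe_toReal (h1.trans_lt (EReal.coe_lt_top _)).ne
      ((EReal.bot_lt_coe _).trans_le h2).ne'
  have hmono : ∀ X Y, X ≤ Y → Ebar X ≤ Ebar Y := fun X Y h =>
    EReal.coe_le_coe_iff.1 (by rw [hcoe, hcoe]; exact barExtension_mono h)
  have hextR : ∀ X : M, Ebar (Submodule.inclusion hM X) = E X := fun X =>
    EReal.coe_eq_coe_iff.1 (by rw [hcoe]; exact hext X)
  -- Together with `hlt`, this expresses `Ebar` as a supremum of real affine functionals $\nu-B$,
  -- avoiding extended arithmetic.
  have hFY : ∀ (ν : ProbabilityMeasure Ω) (B : ℝ),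
      (∀ Z, (integralFunctional ν ∘ₗ Submodule.inclusion hM) Z - E Z ≤ B) →
      ∀ X : LInfty Ω, integralFunctional ν X - B ≤ Ebar X := by
    intro ν B hB X
    refine EReal.coe_le_coe_iff.1 ?_
    rw [hcoe, hrep]
    refine le_iSup_of_le ν (coe_le_coe_sub_conjugate fun Z => ?_)
    linarith [hB Z]
  have hlt : ∀ (X : LInfty Ω) (c : ℝ), c < Ebar X → ∃ (ν : ProbabilityMeasure Ω) (B : ℝ),
      (∀ Z, (integralFunctional ν ∘ₗ Submodule.inclusion hM) Z - E Z ≤ B) ∧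
      c < integralFunctional ν X - B := by
    intro X c hc
    rw [← EReal.coe_lt_coe_iff, hcoe, hrep] at hc
    obtain ⟨ν, hν⟩ := lt_iSup_iff.1 hc
    rcases conjugate_eq_top_or E (integralFunctional ν ∘ₗ Submodule.inclusion hM) with h | ⟨B, h, hB⟩
    · rw [h, EReal.sub_top] at hν
      exact absurd hν not_lt_bot
    · rw [h, ← EReal.coe_sub, EReal.coe_lt_coe_iff] at hν
      exact ⟨ν, B, hB, hν⟩
  have hpre : IsPreExpectation Ebar :=
    ⟨hmono, fun a _ => (hextR ⟨fun _ => a, const_mem hone a⟩).trans (hE.const a _)⟩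
  have hconvex : ConvexOn ℝ Set.univ Ebar := by
    refine ⟨convex_univ, fun X _ Y _ a b ha hb hab => le_of_forall_lt fun c hc => ?_⟩
    obtain ⟨ν, B, hB, hν⟩ := hlt _ c hc
    rw [map_add, map_smul, map_smul] at hν
    have h1 := mul_le_mul_of_nonneg_left (hFY ν B hB X) ha
    have h2 := mul_le_mul_of_nonneg_left (hFY ν B hB Y) hb
    have h3 : B = a * B + b * B := by rw [← add_mul, hab, one_mul]
    simp only [smul_eq_mul] at hν ⊢
    linarith
  have hrep' : ∀ X : LInfty Ω, (Ebar X : EReal) = ⨆ ν : ProbabilityMeasure Ω,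
      ((integralFunctional ν X : ℝ) : EReal)
        - conjugate E (integralFunctional ν ∘ₗ Submodule.inclusion hM) := fun X => by
    rw [hcoe, hrep]
  refine ⟨Ebar, hcoe, hpre, ?_, ?_, hextR, ?_, hconvex, ?_, hrep', hpre, hconvex, Set.univ, ?_⟩
  · intro Xs X hX hlim
    have hle : ∀ n, Xs n ≤ X := fun n ω =>
      Monotone.ge_of_tendsto (f := fun n => (Xs n : Ω → ℝ) ω) (fun _ _ h => hX h ω) (hlim ω) n
    refine ⟨fun m n h => hmono _ _ (hX h), tendsto_order.2 ⟨fun c hc => ?_, fun c hc =>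
      Eventually.of_forall fun n => (hmono _ _ (hle n)).trans_lt hc⟩⟩
    obtain ⟨ν, B, hB, hν⟩ := hlt X c hc
    have hν' := (continuousFromBelow_integralFunctional ν Xs X hX hlim).2.eventually_const_lt
      (lt_sub_iff_add_lt.1 hν)
    filter_upwards [hν'] with n hn
    linarith [hFY ν B hB (Xs n)]
  · intro Xs X hXs _ hX hlim
    have hle : ∀ n, X ≤ Xs n := fun n ω =>
      Antitone.le_of_tendsto (f := fun n => (Xs n : Ω → ℝ) ω) (fun _ _ h => hX h ω) (hlim ω) n
    refine ⟨fun m n h => hmono _ _ (hX h), tendsto_order.2 ⟨fun c hc =>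
      Eventually.of_forall fun n => hc.trans_le (hmono _ _ (hle n)), fun c hc => ?_⟩⟩
    obtain ⟨Ws, hW, hXW, hWX⟩ :=
      exists_antitone_diagonal hRiesz (Xs := fun n => (Xs n : Ω → ℝ)) hXs (fun m n h => hX h) hlim
    -- Otherwise the diagonal sequence would witness $\bar E(X)\ge c$.
    obtain ⟨n, hn⟩ : ∃ n, E (Ws n) < c := by
      by_contra! h
      have := coe_le_barExtension hW hWX h
      rw [← hcoe, EReal.coe_le_coe_iff] at this
      exact absurd this (not_le.2 hc)
    refine eventually_atTop.2 ⟨n, fun m hm => lt_of_le_of_lt ?_ hn⟩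
    rw [← hextR]
    exact (hmono _ _ (hX hm)).trans (hmono _ _ (hXW n))
  · intro F hF hb ha hFE
    funext X
    refine EReal.coe_eq_coe_iff.1 ?_
    rw [hcoe, ← barExtension_comp_inclusion hM hone hRiesz hσ hF.mono hb ha X]
    congr 1
    exact funext hFE
  · intro X
    rw [hrep', iSup_supDual_eq_iSup_probabilityMeasure hM hone hRiesz hσ hE habove]
  · intro X
    rw [hrep']
    -- The minorant $\nu-B\le E$ persists from `M` to all bounded measurable functions, so extending
    -- does not change the conjugate and all probability measures may serve as `P`.
    have hconj : ∀ ν : ProbabilityMeasure Ω, conjugate Ebar (integralFunctional ν) =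
        conjugate E (integralFunctional ν ∘ₗ Submodule.inclusion hM) := by
      intro ν
      refine le_antisymm ?_ (iSup_le fun Z => ?_)
      · rcases conjugate_eq_top_or E (integralFunctional ν ∘ₗ Submodule.inclusion hM) with
          h | ⟨B, h, hB⟩
        · rw [h]
          exact le_top
        · rw [h, conjugate_le_coe_iff]
          exact fun Y => by linarith [hFY ν B hB Y]
      · refine le_iSup_of_le (Submodule.inclusion hM Z) ?_
        rw [hextR]
        rfl
    simp only [hconj, Set.mem_univ, iSup_pos]
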